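/- Let $(\Omega,\mathscr F,\mathbb P)$ be a probability space, let $\theta=(\theta(1),\dots,\theta(r))^T\in\mathbb R^r$ be an unknown parameter vector, and consider the stochastic system $$y_{k+1}=\theta^T\varphi_k+w_{k+1},\qquad k\ge 0,$$ with scalar outputs $y_k$, regressors $\varphi_k\in\mathbb R^r$ and noise $w_k$. Let $u_k$ be the system inputs and $w'_k$ exogenous signals, and put $$\mathcal F_k=\sigma\{y_k,\dots,y_0,\;u_{k-1},\dots,u_0,\;w_k,\dots,w_0,\;w'_k,\dots,w'_0\},\qquad k\ge1 .$$ (No control law is prescribed, so feedback is allowed.) Denote by $\lambda_{\max}(N)$ and $\lambda_{\min}(N)$ the largest and smallest eigenvalues of $\sum_{k=1}^N\varphi_k\varphi_k^T$. From the data $\{\varphi_k,y_{k+1}\}_{k=1}^N$ form the least squares estimate $$\theta_{N+1}=\Big(\sum_{k=1}^N\varphi_k\varphi_k^T\Big)^{-1}\sum_{k=1}^N\varphi_ky_{k+1},$$ the modified estimate $$\widehat\theta_{N+1}(j)=\theta_{N+1}(j)+\operatorname{sgn}\big(\theta_{N+1}(j)\big)\sqrt{\frac{\log\lambda_{\max}(N)}{\lambda_{\min}(N)}},\qquad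 j=1,\dots,r,$$ where $\operatorname{sgn}(x)=1$ for $x\ge0$ and $\operatorname{sgn}(x)=-1$ for $x<0$, and, with coefficients $\lambda_N>0$, the estimate $$\beta_{N+1}\in\operatorname*{argmin}_{\beta\in\mathbb R^r}\;\Big\{\sum_{k=1}^N\big(y_{k+1}-\beta^T\varphi_k\big)^2+\lambda_N\sum_{l=1}^r\frac{|\beta(l)|}{|\widehat\theta_{N+1}(l)|}\Big\}.$$ Assume: A1) the $w_{k+1}$, $k\ge1$, are integrable with $\mathbb E[w_{k+1}\mid\mathcal F_k]=0$, and for some $\gamma>2$, $\sup_{k\ge1}\mathbb E\big[|w_{k+1}|^\gamma\mid\mathcal F_k\big]<\infty$ a.s.; A2) $\varphi_k$ is $\mathcal F_k$-measurable for each $k\ge1$; A3) a.s., $\lambda_{\min}(N)>0$ and $\lambda_{\max}(N)>1$ for all sufficiently large $N$ (so that the quantities below are eventually well defined and positive), and $$\frac{\lambda_{\max}(N)}{\lambda_{\min}(N)}\sqrt{\frac{\log\lambda_{\max}(N)}{\lambda_{\min}(N)}}\longrightarrow0\quad(N\to\infty)\quad\text{a.s.};$$ A4) $\{\lambda_N\}$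 is a positive sequence, possibly depending on the data, such that a.s., as $N\to\infty$, $$\frac{\lambda_N}{\lambda_{\min}(N)}\to0,\qquad \frac{1}{\lambda_N}\,\lambda_{\max}(N)\sqrt{\frac{\log\lambda_{\max}(N)}{\lambda_{\min}(N)}}\to0 .$$ Then there is $\Omega_0$ with $\mathbb P(\Omega_0)=1$ such that for every $\omega\in\Omega_0$ there is an integer $N_0(\omega)$ with $$\beta_{N+1}(j)=0\quad\text{for all }N\ge N_0(\omega)\text{ and all }j\text{ with }\theta(j)=0,$$ and $$\beta_{N+1}(i)\longrightarrow\theta(i)\quad(N\to\infty)\qquad\text{for all }i\text{ with }\theta(i)\ne0 .$$ -/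

import Mathlib

open MeasureTheory Filter Topology

noncomputable section

namespace SparseId

/-- The information available at time `k`: the sigma-algebra generated by
`y 0, …, y k`, `u 0, …, u (k-1)`, `w 0, …, w k`, `w' 0, …, w' k`. -/
abbrev info {Ω U V : Type*} [MeasurableSpace U] [MeasurableSpace V]
    (y : ℕ → Ω → ℝ) (u : ℕ → Ω → U) (w : ℕ → Ω → ℝ) (w' : ℕ → Ω → V) (k : ℕ) :
    MeasurableSpace Ω :=
  (⨆ i ∈ Set.Iic k, MeasurableSpace.comap (y i) inferInstance) ⊔
  (⨆ i ∈ Set.Iio k, MeasurableSpace.comap (u i) inferInstance) ⊔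
  (⨆ i ∈ Set.Iic k, MeasurableSpace.comap (w i) inferInstance) ⊔
  (⨆ i ∈ Set.Iic k, MeasurableSpace.comap (w' i) inferInstance)

/-- The sign function with the convention `sgn 0 = 1`. -/
def sgn (x : ℝ) : ℝ := if 0 ≤ x then 1 else -1

/-- Largest eigenvalue of a symmetric matrix. -/
def eigMax {r : ℕ} (M : Matrix (Fin r) (Fin r) ℝ) : ℝ := sSup (spectrum ℝ M)

/-- Smallest eigenvalue of a symmetric matrix. -/
def eigMin {r : ℕ} (M : Matrix (Fin r) (Fin r) ℝ) : ℝ := sInf (spectrum ℝ M)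

section Data

/- One sample path of the regressors `x k` and of the outputs `z k`. -/
variable {r : ℕ} (x : ℕ → Fin r → ℝ) (z : ℕ → ℝ)

/-- The matrix `∑_{k=1}^N x_k x_kᵀ`. -/
def gram (N : ℕ) : Matrix (Fin r) (Fin r) ℝ :=
  ∑ k ∈ Finset.Icc 1 N, Matrix.vecMulVec (x k) (x k)

/-- `λ_max(N)`. -/
def lamMax (N : ℕ) : ℝ := eigMax (gram x N)

/-- `λ_min(N)`. -/
def lamMin (N : ℕ) : ℝ := eigMin (gram x N)

/-- `√(log λ_max(N) / λ_min(N))`. -/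
def rate (N : ℕ) : ℝ := Real.sqrt (Real.log (lamMax x N) / lamMin x N)

/-- The least squares estimate `θ_{N+1}` based on `(x_k, z_{k+1})`, `1 ≤ k ≤ N`. -/
def lsEstimate (N : ℕ) : Fin r → ℝ :=
  Matrix.mulVec (gram x N)⁻¹ (∑ k ∈ Finset.Icc 1 N, z (k + 1) • x k)

/-- The modified least squares estimate `θ̂_{N+1}`. -/
def modEstimate (N : ℕ) (j : Fin r) : ℝ :=
  lsEstimate x z N j + sgn (lsEstimate x z N j) * rate x N

/-- The criterion `J_{N+1}(b)` with regularization coefficient `c` (that is, `c = λ_N`). -/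
def criterion (c : ℝ) (N : ℕ) (b : Fin r → ℝ) : ℝ :=
  ∑ k ∈ Finset.Icc 1 N, (z (k + 1) - b ⬝ᵥ x k) ^ 2 +
    c * ∑ l, 1 / |modEstimate x z N l| * |b l|

end Data

end SparseId

end

/-! The least squares error is controlled by the self-normalized score `Sᵀ G⁻¹ S`, where
`S = ∑ w_{k+1} φ_k` and `G` is the regularized Gram matrix. As in Lai and Wei, expanding `Sᵀ G⁻¹ S`
when one regressor is added produces a martingale transform, the squared noise weighted by the
leverages, and a negative quadratic term. A strong law for martingale transforms, valid because
the noise has conditional moments of an order above two, absorbs the first into the third and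
replaces the squared noise by its bounded conditional mean; the leverages sum to at most
`log det G`. Hence almost surely `Sᵀ G⁻¹ S = O(log λ_max)`, and the least squares error is
`O(√(log λ_max / λ_min))`, the very quantity by which the modified estimate is shifted.

From here on a sample path is fixed. At a nonzero coordinate of `θ` the penalty weight stays
bounded, so `λ_N / λ_min → 0` makes the minimizer consistent. At a zero coordinate `j` the modified
estimate is `O(√(log λ_max / λ_min))`. If `β(j) ≠ 0`, replacing `β(j)` by zero would raise the sum
of squares by `O(λ_max |β(j)|)` only, while lowering the penalty by `λ_N |β(j)| / |θ̂(j)|`, which is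
of larger order by the second half of A4; a minimizer therefore has `β(j) = 0`.
-/

noncomputable section

namespace SparseId

open scoped ENNReal

open Matrix

section SelfNormalized

variable {ι : Type*}

/-- The score `∑_{k<n} v_k x_k` of the noise `v` against the regressors `x`. -/
def score (x : ℕ → ι → ℝ) (v : ℕ → ℝ) (n : ℕ) : ι → ℝ :=
  ∑ k ∈ Finset.range n, v k • x k

theorem score_succ (x : ℕ → ι → ℝ) (v : ℕ → ℝ) (n : ℕ) :
    score x v (n + 1) = score x v n + v n • x n :=
  Finset.sum_range_succ _ _

/-- The regularized Gram matrix `1 + ∑_{k<n} x_k x_kᵀ`; the identity makes it invertible from the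
start. -/
def regGram [DecidableEq ι] (x : ℕ → ι → ℝ) (n : ℕ) : Matrix ι ι ℝ :=
  1 + ∑ k ∈ Finset.range n, vecMulVec (x k) (x k)

theorem regGram_succ [DecidableEq ι] (x : ℕ → ι → ℝ) (n : ℕ) :
    regGram x (n + 1) = regGram x n + vecMulVec (x n) (x n) := by
  rw [regGram, Finset.sum_range_succ, ← add_assoc, regGram]

theorem measurable_regGram_apply [DecidableEq ι] {Ω : Type*} {m : MeasurableSpace Ω}
    {x : ℕ → Ω → ι → ℝ} {n : ℕ} (hx : ∀ k < n, Measurable (x k)) (i j : ι) :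
    Measurable fun ω => regGram (x · ω) n i j := by
  simp only [regGram, Matrix.add_apply, Matrix.sum_apply, vecMulVec_apply]
  refine measurable_const.add (Finset.measurable_fun_sum _ fun k hk => ?_)
  have hxk := measurable_pi_iff.1 (hx k (Finset.mem_range.1 hk))
  exact (hxk i).mul (hxk j)

section Finite

variable [Finite ι]

theorem posSemidef_vecMulVec_self (x : ι → ℝ) : (vecMulVec x x).PosSemidef := by
  simpa only [star_trivial] using posSemidef_vecMulVec_self_star x

theorem posDef_add_vecMulVec_self {G : Matrix ι ι ℝ} (hG : G.PosDef) (x : ι → ℝ) :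
    (G + vecMulVec x x).PosDef :=
  hG.add_posSemidef (posSemidef_vecMulVec_self x)

theorem posDef_regGram [DecidableEq ι] (x : ℕ → ι → ℝ) (n : ℕ) : (regGram x n).PosDef :=
  PosDef.one.add_posSemidef (posSemidef_sum _ fun k _ => posSemidef_vecMulVec_self (x k))

end Finite

variable [Fintype ι] {G : Matrix ι ι ℝ}

theorem dotProduct_mulVec_comm_of_isHermitian (hG : G.IsHermitian) (a b : ι → ℝ) :
    a ⬝ᵥ G *ᵥ b = b ⬝ᵥ G *ᵥ a := by
  have hGT : Gᵀ = G := by rw [← conjTranspose_eq_transpose_of_trivial, hG.eq]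
  rw [dotProduct_mulVec, ← mulVec_transpose, hGT, dotProduct_comm]

variable [DecidableEq ι]

theorem det_sub_vecMulVec_self (hG : IsUnit G.det) (x : ι → ℝ) :
    (G - vecMulVec x x).det = G.det * (1 - x ⬝ᵥ G⁻¹ *ᵥ x) := by
  have hrank : G - vecMulVec x x = G + replicateCol Unit (-x) * replicateRow Unit x := by
    rw [← vecMulVec_eq, neg_vecMulVec, sub_eq_add_neg]
  have hdet : (1 + replicateRow Unit x * G⁻¹ * replicateCol Unit (-x)).det =
      1 - x ⬝ᵥ G⁻¹ *ᵥ x := by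
    rw [det_unique, Matrix.add_apply, one_apply_eq, Matrix.mul_assoc, sub_eq_add_neg,
      ← dotProduct_neg, ← mulVec_neg]
    rfl
  rw [hrank, det_add_replicateCol_mul_replicateRow hG, hdet]

/-- The leverage `xᵀ (G + x xᵀ)⁻¹ x` of a new regressor `x` when the Gram matrix of the previous
ones is `G`. -/
def leverage (G : Matrix ι ι ℝ) (x : ι → ℝ) : ℝ :=
  x ⬝ᵥ (G + vecMulVec x x)⁻¹ *ᵥ x

theorem one_sub_leverage (hG : G.PosDef) (x : ι → ℝ) :
    1 - leverage G x = G.det / (G + vecMulVec x x).det := by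
  have hdet := (posDef_add_vecMulVec_self hG x).det_pos.ne'
  have h := det_sub_vecMulVec_self hdet.isUnit x
  rw [add_sub_cancel_right] at h
  rw [leverage, eq_div_iff hdet, h, mul_comm]

theorem leverage_nonneg (hG : G.PosDef) (x : ι → ℝ) : 0 ≤ leverage G x := by
  simpa only [star_trivial, leverage] using
    (posDef_add_vecMulVec_self hG x).inv.posSemidef.dotProduct_mulVec_nonneg x

theorem leverage_le_one (hG : G.PosDef) (x : ι → ℝ) : leverage G x ≤ 1 := by
  rw [← sub_nonneg, one_sub_leverage hG]
  exact (div_pos hG.det_pos (posDef_add_vecMulVec_self hG x).det_pos).le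

theorem leverage_le_log_det_sub (hG : G.PosDef) (x : ι → ℝ) :
    leverage G x ≤ Real.log (G + vecMulVec x x).det - Real.log G.det := by
  have hG' := posDef_add_vecMulVec_self hG x
  have hlog := Real.log_le_sub_one_of_pos (div_pos hG.det_pos hG'.det_pos)
  rw [Real.log_div hG.det_pos.ne' hG'.det_pos.ne', ← one_sub_leverage hG] at hlog
  linarith

theorem dotProduct_inv_add_vecMulVec_self_mulVec (hG : G.PosDef) (x S : ι → ℝ) (v : ℝ) :
    (S + v • x) ⬝ᵥ (G + vecMulVec x x)⁻¹ *ᵥ (S + v • x) =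
      S ⬝ᵥ G⁻¹ *ᵥ S - (x ⬝ᵥ G⁻¹ *ᵥ S) ^ 2 * (1 - leverage G x)
        + 2 * ((x ⬝ᵥ G⁻¹ *ᵥ S) * (1 - leverage G x) * v) + leverage G x * v ^ 2 := by
  have hG' := posDef_add_vecMulVec_self hG x
  unfold leverage
  set G' := G + vecMulVec x x with hG'def
  set a := x ⬝ᵥ G'⁻¹ *ᵥ x with ha
  set t := G⁻¹ *ᵥ S with ht
  set q := x ⬝ᵥ t with hq
  have hS : S = G' *ᵥ t - q • x := by
    rw [hG'def, add_mulVec, vecMulVec_mulVec, ht, mulVec_mulVec,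
      mul_nonsing_inv _ hG.det_pos.ne'.isUnit, one_mulVec, op_smul_eq_smul, add_sub_cancel_right]
  have hG'S : G'⁻¹ *ᵥ S = t - q • G'⁻¹ *ᵥ x := by
    conv_lhs => rw [hS]
    rw [mulVec_sub, mulVec_mulVec, nonsing_inv_mul _ hG'.det_pos.ne'.isUnit, mulVec_smul,
      one_mulVec]
  have hxS : x ⬝ᵥ G'⁻¹ *ᵥ S = q * (1 - a) := by
    rw [hG'S, dotProduct_sub, dotProduct_smul, ← hq, ← ha, smul_eq_mul]
    ring
  have hSx : S ⬝ᵥ G'⁻¹ *ᵥ x = q * (1 - a) := by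
    rw [dotProduct_mulVec_comm_of_isHermitian hG'.inv.1, hxS]
  have hSS : S ⬝ᵥ G'⁻¹ *ᵥ S = S ⬝ᵥ t - q ^ 2 * (1 - a) := by
    conv_lhs => rw [hG'S]
    rw [dotProduct_sub, dotProduct_smul, hSx, smul_eq_mul]
    ring
  simp only [mulVec_add, mulVec_smul, add_dotProduct, dotProduct_add, smul_dotProduct,
    dotProduct_smul, hSS, hSx, hxS, ← ha, smul_eq_mul]
  ring

/-- The value at `x_n` of the ridge regression of the noise `v` on the earlier regressors. -/
def ridgePrediction (x : ℕ → ι → ℝ) (v : ℕ → ℝ) (n : ℕ) : ℝ :=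
  x n ⬝ᵥ (regGram x n)⁻¹ *ᵥ score x v n

/-- The squared norm of the score, normalized by the regularized Gram matrix. -/
def selfNormalizedScore (x : ℕ → ι → ℝ) (v : ℕ → ℝ) (n : ℕ) : ℝ :=
  score x v n ⬝ᵥ (regGram x n)⁻¹ *ᵥ score x v n

theorem selfNormalizedScore_nonneg (x : ℕ → ι → ℝ) (v : ℕ → ℝ) (n : ℕ) :
    0 ≤ selfNormalizedScore x v n := by
  simpa only [star_trivial, selfNormalizedScore] using
    (posDef_regGram x n).inv.posSemidef.dotProduct_mulVec_nonneg (score x v n)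

theorem selfNormalizedScore_add_sum (x : ℕ → ι → ℝ) (v : ℕ → ℝ) (n : ℕ) :
    selfNormalizedScore x v n +
        ∑ k ∈ Finset.range n, ridgePrediction x v k ^ 2 * (1 - leverage (regGram x k) (x k)) =
      2 * ∑ k ∈ Finset.range n,
          ridgePrediction x v k * (1 - leverage (regGram x k) (x k)) * v k +
        ∑ k ∈ Finset.range n, leverage (regGram x k) (x k) * v k ^ 2 := by
  induction n with
  | zero => simp [selfNormalizedScore, score]
  | succ n ih =>
    have hstep := dotProduct_inv_add_vecMulVec_self_mulVec (posDef_regGram x n) (x n)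
      (score x v n) (v n)
    rw [← regGram_succ, ← score_succ, ← ridgePrediction, ← selfNormalizedScore,
      ← selfNormalizedScore] at hstep
    simp only [Finset.sum_range_succ]
    linarith

theorem sum_leverage_le_log_det (x : ℕ → ι → ℝ) (n : ℕ) :
    ∑ k ∈ Finset.range n, leverage (regGram x k) (x k) ≤ Real.log (regGram x n).det := by
  induction n with
  | zero => simp [regGram]
  | succ n ih =>
    rw [Finset.sum_range_succ, regGram_succ]
    linarith [leverage_le_log_det_sub (posDef_regGram x n) (x n)]

theorem log_det_regGram_nonneg (x : ℕ → ι → ℝ) (n : ℕ) : 0 ≤ Real.log (regGram x n).det :=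
  (Finset.sum_nonneg fun k _ => leverage_nonneg (posDef_regGram x k) (x k)).trans
    (sum_leverage_le_log_det x n)

theorem selfNormalizedScore_le (x : ℕ → ι → ℝ) (v g : ℕ → ℝ) {K A B : ℝ} {n : ℕ}
    (hK : 0 ≤ K) (hg : ∀ k, g k ≤ K)
    (hA : ∑ k ∈ Finset.range n, leverage (regGram x k) (x k) * (v k ^ 2 - g k) ≤
      ∑ k ∈ Finset.range n, leverage (regGram x k) (x k) + A)
    (hB : ∑ k ∈ Finset.range n, ridgePrediction x v k * (1 - leverage (regGram x k) (x k)) * v k ≤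
      1 / 2 * ∑ k ∈ Finset.range n,
        ridgePrediction x v k ^ 2 * (1 - leverage (regGram x k) (x k)) + B) :
    selfNormalizedScore x v n ≤ (1 + K) * Real.log (regGram x n).det + (A + 2 * B) := by
  have hsq : ∑ k ∈ Finset.range n, leverage (regGram x k) (x k) * v k ^ 2 ≤
      ∑ k ∈ Finset.range n, leverage (regGram x k) (x k) * (v k ^ 2 - g k) +
        K * ∑ k ∈ Finset.range n, leverage (regGram x k) (x k) := by
    rw [Finset.mul_sum, ← Finset.sum_add_distrib]
    gcongr with k
    linarith [mul_le_mul_of_nonneg_left (hg k) (leverage_nonneg (posDef_regGram x k) (x k))]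
  have hlog : (1 + K) * ∑ k ∈ Finset.range n, leverage (regGram x k) (x k) ≤
      (1 + K) * Real.log (regGram x n).det := by
    gcongr
    exact sum_leverage_le_log_det x n
  linarith [selfNormalizedScore_add_sum x v n]

section Measurability

variable {Ω : Type*} {m : MeasurableSpace Ω} {M : Ω → Matrix ι ι ℝ} {x : ℕ → Ω → ι → ℝ}
  {v : ℕ → Ω → ℝ} {n : ℕ}

theorem measurable_matrix_det (hM : ∀ i j, Measurable fun ω => M ω i j) :
    Measurable fun ω => (M ω).det := by
  simp only [det_apply]
  exact Finset.measurable_fun_sum _ fun σ _ =>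
    (Finset.measurable_fun_prod _ fun i _ => hM _ _).const_smul _

theorem measurable_matrix_inv_apply (hM : ∀ i j, Measurable fun ω => M ω i j) (i j : ι) :
    Measurable fun ω => (M ω)⁻¹ i j := by
  simp only [inv_def, Ring.inverse_eq_inv', Matrix.smul_apply, adjugate_apply, smul_eq_mul]
  refine (measurable_matrix_det hM).inv.mul (measurable_matrix_det fun k l => ?_)
  simp only [updateRow_apply]
  split_ifs
  · exact measurable_const
  · exact hM k l

theorem measurable_dotProduct_inv_mulVec (hM : ∀ i j, Measurable fun ω => M ω i j)
    {a b : Ω → ι → ℝ} (ha : Measurable a) (hb : Measurable b) :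
    Measurable fun ω => a ω ⬝ᵥ (M ω)⁻¹ *ᵥ b ω := by
  simp only [dotProduct, mulVec]
  exact Finset.measurable_fun_sum _ fun i _ => (measurable_pi_iff.1 ha i).mul <|
    Finset.measurable_fun_sum _ fun j _ =>
      (measurable_matrix_inv_apply hM i j).mul (measurable_pi_iff.1 hb j)

theorem measurable_leverage (hM : ∀ i j, Measurable fun ω => M ω i j) {a : Ω → ι → ℝ}
    (ha : Measurable a) : Measurable fun ω => leverage (M ω) (a ω) :=
  measurable_dotProduct_inv_mulVec (fun i j => (hM i j).add <|
    (measurable_pi_iff.1 ha i).mul (measurable_pi_iff.1 ha j)) ha ha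

theorem measurable_ridgePrediction (hx : ∀ k ≤ n, Measurable (x k))
    (hv : ∀ k < n, Measurable (v k)) :
    Measurable fun ω => ridgePrediction (x · ω) (v · ω) n := by
  refine measurable_dotProduct_inv_mulVec
    (measurable_regGram_apply fun k hk => hx k hk.le) (hx n le_rfl) ?_
  unfold score
  exact Finset.measurable_fun_sum _ fun k hk =>
    (hv k (Finset.mem_range.1 hk)).smul (hx k (Finset.mem_range.1 hk).le)

end Measurability

end SelfNormalized
theorem abs_one_add_rpow_le {p : ℝ} (hp1 : 1 < p) (hp2 : p ≤ 2) (t : ℝ) :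
    |1 + t| ^ p ≤ 1 + p * t + 6 * |t| ^ p := by
  rcases le_total |t| 1 with ht | ht
  · have ht' := abs_le.1 ht
    have h1 : 0 ≤ 1 + t := by linarith
    have hsplit : |1 + t| ^ p = (1 + t) * (1 + t) ^ (p - 1) := by
      rw [abs_of_nonneg h1, ← Real.rpow_one_add' h1 (by linarith), add_sub_cancel]
    have hbernoulli :=
      rpow_one_add_le_one_add_mul_self ht'.1 (p := p - 1) (by linarith) (by linarith)
    have hsq : t ^ 2 ≤ |t| ^ p := by
      rw [← sq_abs, ← Real.rpow_two]
      exact Real.rpow_le_rpow_of_exponent_ge' (abs_nonneg t) ht (by linarith) hp2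
    rw [hsplit]
    nlinarith [mul_le_mul_of_nonneg_left hbernoulli h1, sq_nonneg t]
  · have htwo : (2 : ℝ) ^ p ≤ 4 := by
      calc (2 : ℝ) ^ p ≤ 2 ^ (2 : ℝ) := Real.rpow_le_rpow_of_exponent_le (by norm_num) hp2
        _ = 4 := by norm_num
    have hself : |t| ≤ |t| ^ p := Real.self_le_rpow_of_one_le ht hp1.le
    have hlin : -(p * t) ≤ 2 * |t| := by nlinarith [neg_abs_le t, abs_nonneg t]
    have hadd : |1 + t| ≤ 2 * |t| := by
      calc |1 + t| ≤ |1| + |t| := abs_add_le _ _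
        _ ≤ 2 * |t| := by rw [abs_one]; linarith
    calc |1 + t| ^ p ≤ (2 * |t|) ^ p := by gcongr
      _ = 2 ^ p * |t| ^ p := Real.mul_rpow zero_le_two (abs_nonneg t)
      _ ≤ 4 * |t| ^ p := by gcongr
      _ ≤ 1 + p * t + 6 * |t| ^ p := by linarith

theorem abs_add_rpow_le {p : ℝ} (hp1 : 1 < p) (hp2 : p ≤ 2) (x y : ℝ) :
    |x + y| ^ p ≤ |x| ^ p + p * (x * |x| ^ (p - 2)) * y + 6 * |y| ^ p := by
  rcases eq_or_ne x 0 with rfl | hx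
  · have : 0 ≤ |y| ^ p := by positivity
    rw [abs_zero, Real.zero_rpow (by linarith), zero_add, zero_mul, mul_zero, zero_mul]
    linarith
  have hx' : 0 < |x| := abs_pos.2 hx
  have hscale : ∀ s, |x * s| ^ p = |x| ^ p * |s| ^ p := fun s => by
    rw [abs_mul, Real.mul_rpow (abs_nonneg _) (abs_nonneg _)]
  have hsum : |x + y| ^ p = |x| ^ p * |1 + y / x| ^ p := by
    rw [← hscale, mul_add, mul_one, mul_div_cancel₀ y hx]
  have hy : |y| ^ p = |x| ^ p * |y / x| ^ p := by
    rw [← hscale, mul_div_cancel₀ y hx]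
  have hcross : |x| ^ p * (y / x) = x * |x| ^ (p - 2) * y := by
    have : |x| ^ p = |x| ^ (p - 2) * (x * x) := by
      rw [← abs_mul_abs_self x, ← sq, ← Real.rpow_natCast, ← Real.rpow_add hx']
      norm_num
    rw [this]
    field_simp
  calc |x + y| ^ p ≤ |x| ^ p * (1 + p * (y / x) + 6 * |y / x| ^ p) := by
        rw [hsum]
        gcongr
        exact abs_one_add_rpow_le hp1 hp2 _
    _ = |x| ^ p + p * (|x| ^ p * (y / x)) + 6 * (|x| ^ p * |y / x| ^ p) := by ring
    _ = _ := by rw [hcross, ← hy]; ring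

theorem abs_mul_rpow_mul_le {p : ℝ} (hp1 : 1 < p) (x y : ℝ) :
    |x * |x| ^ (p - 2) * y| ≤ |x| ^ p + |y| ^ p := by
  have hsplit : ∀ z : ℝ, |z| ^ p = |z| ^ (p - 1) * |z| := fun z => by
    rw [← Real.rpow_add_one' (abs_nonneg z) (by linarith), sub_add_cancel]
  have hxp : |x * |x| ^ (p - 2) * y| = |x| ^ (p - 1) * |y| := by
    rw [abs_mul, abs_mul, Real.abs_rpow_of_nonneg (abs_nonneg x), abs_abs,
      ← Real.rpow_one_add' (abs_nonneg x) (by linarith)]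
    ring_nf
  have hx : 0 ≤ |x| ^ p := by positivity
  have hy : 0 ≤ |y| ^ p := by positivity
  rw [hxp]
  rcases le_total |x| |y| with h | h
  · calc |x| ^ (p - 1) * |y| ≤ |y| ^ (p - 1) * |y| := by gcongr
      _ ≤ |x| ^ p + |y| ^ p := by rw [← hsplit]; linarith
  · calc |x| ^ (p - 1) * |y| ≤ |x| ^ (p - 1) * |x| := by gcongr
      _ ≤ |x| ^ p + |y| ^ p := by rw [← hsplit]; linarith

theorem rpow_le_one_add_rpow {x a b : ℝ} (hx : 0 ≤ x) (ha : 0 ≤ a) (hab : a ≤ b) :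
    x ^ a ≤ 1 + x ^ b := by
  rcases le_total x 1 with h | h
  · have := Real.rpow_le_one hx h ha
    have : 0 ≤ x ^ b := by positivity
    linarith
  · have := Real.rpow_le_rpow_of_exponent_le h hab
    linarith

theorem exists_eventually_abs_sum_mul_le {x C : ℕ → ℝ} {l : ℝ} (hC : Monotone C)
    (hC0 : ∀ n, 0 ≤ C n) (hx : Tendsto (fun n => ∑ k ∈ Finset.range n, x k) atTop (𝓝 l))
    {δ : ℝ} (hδ : 0 < δ) :
    ∃ A, ∀ᶠ n in atTop, |∑ k ∈ Finset.range n, C (k + 1) * x k| ≤ δ * C n + A := by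
  let t : ℕ → ℝ := fun n => l - ∑ k ∈ Finset.range n, x k
  let Y : ℕ → ℝ := fun n => ∑ k ∈ Finset.range n, C (k + 1) * x k + C n * t n
  have ht : Tendsto t atTop (𝓝 0) := by simpa only [sub_self] using hx.const_sub l
  have hYstep : ∀ n, Y (n + 1) = Y n + (C (n + 1) - C n) * t n := fun n => by
    simp only [Y, t, Finset.sum_range_succ]
    ring
  obtain ⟨N, hN⟩ := eventually_atTop.1 <|
    ht.abs.eventually_le_const (abs_zero.trans_lt (half_pos hδ))
  have hY : ∀ n ≥ N, |Y n| ≤ |Y N| + δ / 2 * (C n - C N) := fun n hn => by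
    induction n, hn using Nat.le_induction with
    | base => simp
    | succ n hn ih =>
      have hstep : 0 ≤ C (n + 1) - C n := sub_nonneg.2 (hC n.le_succ)
      calc |Y (n + 1)| ≤ |Y n| + |(C (n + 1) - C n) * t n| := by
            rw [hYstep]; exact abs_add_le _ _
        _ ≤ |Y n| + (C (n + 1) - C n) * (δ / 2) := by
            rw [abs_mul, abs_of_nonneg hstep]; gcongr; exact hN n hn
        _ ≤ |Y N| + δ / 2 * (C (n + 1) - C N) := by linarith
  refine ⟨|Y N|, eventually_atTop.2 ⟨N, fun n hn => ?_⟩⟩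
  have hrem : |C n * t n| ≤ C n * (δ / 2) := by
    rw [abs_mul, abs_of_nonneg (hC0 n)]
    exact mul_le_mul_of_nonneg_left (hN n hn) (hC0 n)
  have hCN : 0 ≤ δ / 2 * C N := mul_nonneg (half_pos hδ).le (hC0 N)
  calc |∑ k ∈ Finset.range n, C (k + 1) * x k| = |Y n - C n * t n| := by rw [add_sub_cancel_right]
    _ ≤ |Y n| + |C n * t n| := abs_sub _ _
    _ ≤ δ * C n + |Y N| := by linarith [hY n hn]

theorem sub_div_rpow_le {a b s : ℝ} (ha : 0 < a) (hb : 0 < b) (hs : 0 < s) :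
    (b - a) / b ^ (1 + s) ≤ s⁻¹ * (a ^ (-s) - b ^ (-s)) := by
  have hlog : s * (b - a) / b ≤ Real.log (a / b) * -s := by
    have h := mul_le_mul_of_nonneg_right (Real.log_le_sub_one_of_pos (div_pos ha hb)) hs.le
    have : s * (b - a) / b = -((a / b - 1) * s) := by field_simp; ring
    linarith
  have hexp : 1 + s * (b - a) / b ≤ (a / b) ^ (-s) := by
    rw [Real.rpow_def_of_pos (div_pos ha hb)]
    linarith [Real.add_one_le_exp (Real.log (a / b) * -s)]
  calc (b - a) / b ^ (1 + s) = s⁻¹ * (b ^ (-s) * (1 + s * (b - a) / b) - b ^ (-s)) := by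
        rw [Real.rpow_add hb, Real.rpow_one, Real.rpow_neg hb.le]
        field_simp
        ring
    _ ≤ s⁻¹ * (b ^ (-s) * (a / b) ^ (-s) - b ^ (-s)) := by
        have : 0 ≤ b ^ (-s) := Real.rpow_nonneg hb.le _
        gcongr
    _ = s⁻¹ * (a ^ (-s) - b ^ (-s)) := by
        rw [← Real.mul_rpow hb.le (div_pos ha hb).le, mul_div_cancel₀ a hb.ne']

theorem summable_div_one_add_sum_rpow {c : ℕ → ℝ} (hc : ∀ n, 0 ≤ c n) {p : ℝ} (hp : 1 < p) :
    Summable fun n => c n / (1 + ∑ k ∈ Finset.range (n + 1), c k) ^ p := by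
  let C : ℕ → ℝ := fun n => 1 + ∑ k ∈ Finset.range n, c k
  have hC : ∀ n, 0 < C n := fun n => by
    have := Finset.sum_nonneg fun k (_ : k ∈ Finset.range n) => hc k
    positivity
  refine summable_of_sum_range_le (c := (p - 1)⁻¹)
    (fun n => div_nonneg (hc n) (Real.rpow_nonneg (hC _).le _)) fun n => ?_
  calc ∑ k ∈ Finset.range n, c k / C (k + 1) ^ p
      ≤ ∑ k ∈ Finset.range n, (p - 1)⁻¹ * (C k ^ (-(p - 1)) - C (k + 1) ^ (-(p - 1))) := by
        refine Finset.sum_le_sum fun k _ => ?_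
        have hstep := sub_div_rpow_le (hC k) (hC (k + 1)) (sub_pos.2 hp)
        have hck : C (k + 1) - C k = c k := by
          simp only [C, Finset.sum_range_succ]
          ring
        rwa [hck, add_sub_cancel] at hstep
    _ = (p - 1)⁻¹ * (1 - C n ^ (-(p - 1))) := by
        rw [← Finset.mul_sum, Finset.sum_range_sub' fun k => C k ^ (-(p - 1))]
        simp [C]
    _ ≤ (p - 1)⁻¹ := by
        have := Real.rpow_nonneg (hC n).le (-(p - 1))
        exact mul_le_of_le_one_right (inv_nonneg.2 (sub_pos.2 hp).le) (by linarith)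

section Martingale

variable {Ω : Type*} {m m0 : MeasurableSpace Ω} {P : Measure Ω} {p q K : ℝ} {f g : Ω → ℝ}

theorem integrable_abs_rpow (hp : 0 < p) (hf : MemLp f (ENNReal.ofReal p) P) :
    Integrable (fun ω => |f ω| ^ p) P := by
  simpa [ENNReal.toReal_ofReal hp.le] using hf.integrable_norm_rpow (by simpa using hp) (by simp)

theorem measurable_abs_rpow (hf : Measurable[m] f) : Measurable[m] fun ω => |f ω| ^ p :=
  (by fun_prop : Measurable fun x : ℝ => |x| ^ p).comp hf

theorem integral_mul_eq_zero_of_condExp_eq_zero [IsFiniteMeasure P] (hm : m ≤ m0)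
    (hf : P[f | m] =ᵐ[P] 0) (hfi : Integrable f P) (hg : Measurable[m] g)
    (hgf : Integrable (g * f) P) : ∫ ω, g ω * f ω ∂P = 0 := by
  have hpull := condExp_mul_of_stronglyMeasurable_left (μ := P) hg.stronglyMeasurable hgf hfi
  calc ∫ ω, g ω * f ω ∂P = ∫ ω, (P[g * f | m]) ω ∂P := (integral_condExp hm).symm
    _ = ∫ _, 0 ∂P := integral_congr_ae <| by
        filter_upwards [hf, hpull] with ω hω hω'
        rw [hω', Pi.mul_apply, hω, Pi.zero_apply, mul_zero]
    _ = 0 := integral_zero _ _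

/- The cross term of `abs_add_rpow_le` has mean zero. -/
theorem integral_abs_add_rpow_le [IsFiniteMeasure P] (hm : m ≤ m0) (hp1 : 1 < p) (hp2 : p ≤ 2)
    {X Y : Ω → ℝ} (hX : Measurable[m] X) (hXp : MemLp X (ENNReal.ofReal p) P)
    (hYp : MemLp Y (ENNReal.ofReal p) P) (hY : P[Y | m] =ᵐ[P] 0) :
    ∫ ω, |X ω + Y ω| ^ p ∂P ≤ ∫ ω, |X ω| ^ p ∂P + 6 * ∫ ω, |Y ω| ^ p ∂P := by
  have hp0 : 0 < p := by linarith
  have hYi : Integrable Y P := hYp.integrable (by simpa using ENNReal.ofReal_le_ofReal hp1.le)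
  have hXI := integrable_abs_rpow hp0 hXp
  have hYI := integrable_abs_rpow hp0 hYp
  have hcoef : Measurable[m] fun ω => p * (X ω * |X ω| ^ (p - 2)) :=
    (by fun_prop : Measurable fun x : ℝ => p * (x * |x| ^ (p - 2))).comp hX
  have hcross : Integrable (fun ω => p * (X ω * |X ω| ^ (p - 2)) * Y ω) P := by
    refine ((hXI.add hYI).const_mul p).mono'
      ((hcoef.mono hm le_rfl).aestronglyMeasurable.mul hYi.1) (ae_of_all _ fun ω => ?_)
    rw [mul_assoc, norm_mul, Real.norm_of_nonneg hp0.le]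
    exact mul_le_mul_of_nonneg_left (abs_mul_rpow_mul_le hp1 _ _) hp0.le
  have hlin : Integrable (fun ω => |X ω| ^ p + p * (X ω * |X ω| ^ (p - 2)) * Y ω) P :=
    hXI.add hcross
  calc ∫ ω, |X ω + Y ω| ^ p ∂P
      ≤ ∫ ω, (|X ω| ^ p + p * (X ω * |X ω| ^ (p - 2)) * Y ω + 6 * |Y ω| ^ p) ∂P :=
        integral_mono (integrable_abs_rpow hp0 (hXp.add hYp))
          (hlin.add (hYI.const_mul 6)) fun ω => abs_add_rpow_le hp1 hp2 _ _
    _ = ∫ ω, |X ω| ^ p ∂P + 6 * ∫ ω, |Y ω| ^ p ∂P := by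
        rw [integral_add hlin (hYI.const_mul 6), integral_add hXI hcross,
          integral_mul_eq_zero_of_condExp_eq_zero hm hY hYi hcoef hcross, add_zero,
          integral_const_mul]

/- The von Bahr–Esseen inequality, with 6 in place of the usual constant 2. -/
theorem integral_abs_sum_rpow_le [IsFiniteMeasure P] {ℱ : Filtration ℕ m0}
    (hp1 : 1 < p) (hp2 : p ≤ 2) {Y : ℕ → Ω → ℝ} (hY : ∀ n, Measurable[ℱ (n + 1)] (Y n))
    (hmart : ∀ n, P[Y n | ℱ n] =ᵐ[P] 0) (hYp : ∀ n, MemLp (Y n) (ENNReal.ofReal p) P) (n : ℕ) :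
    ∫ ω, |∑ k ∈ Finset.range n, Y k ω| ^ p ∂P ≤
      6 * ∑ k ∈ Finset.range n, ∫ ω, |Y k ω| ^ p ∂P := by
  induction n with
  | zero => simp [Real.zero_rpow (zero_lt_one.trans hp1).ne']
  | succ n ih =>
    have hSm : Measurable[ℱ n] fun ω => ∑ k ∈ Finset.range n, Y k ω :=
      Finset.measurable_fun_sum _ fun k hk => (hY k).mono (ℱ.mono (Finset.mem_range.1 hk)) le_rfl
    have hstep := integral_abs_add_rpow_le (ℱ.le n) hp1 hp2 hSm
      (memLp_finsetSum _ fun k _ => hYp k) (hYp n) (hmart n)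
    simp only [Finset.sum_range_succ]
    linarith

theorem ae_exists_tendsto_sum_of_summable [IsFiniteMeasure P] {ℱ : Filtration ℕ m0}
    (hp1 : 1 < p) (hp2 : p ≤ 2) {Y : ℕ → Ω → ℝ} (hY : ∀ n, Measurable[ℱ (n + 1)] (Y n))
    (hmart : ∀ n, P[Y n | ℱ n] =ᵐ[P] 0) (hYp : ∀ n, MemLp (Y n) (ENNReal.ofReal p) P)
    (hsum : Summable fun n => ∫ ω, |Y n ω| ^ p ∂P) :
    ∀ᵐ ω ∂P, ∃ l, Tendsto (fun n => ∑ k ∈ Finset.range n, Y k ω) atTop (𝓝 l) := by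
  let S : ℕ → Ω → ℝ := fun n ω => ∑ k ∈ Finset.range n, Y k ω
  have hp0 : 0 < p := by linarith
  have hp1' : 1 ≤ ENNReal.ofReal p := by simpa using ENNReal.ofReal_le_ofReal hp1.le
  have hSm : ∀ n, Measurable[ℱ n] (S n) := fun n =>
    Finset.measurable_fun_sum _ fun k hk => (hY k).mono (ℱ.mono (Finset.mem_range.1 hk)) le_rfl
  have hSp : ∀ n, MemLp (S n) (ENNReal.ofReal p) P := fun n =>
    memLp_finsetSum _ fun k _ => hYp k
  have hmartS : Martingale S ℱ P := by
    refine martingale_of_condExp_sub_eq_zero_nat (fun n => (hSm n).stronglyMeasurable)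
      (fun n => (hSp n).integrable hp1') fun n => ?_
    have : S (n + 1) - S n = Y n := funext fun ω => by
      simp only [S, Pi.sub_apply, Finset.sum_range_succ, add_sub_cancel_left]
    rw [this]
    exact hmart n
  refine hmartS.submartingale.exists_ae_tendsto_of_bdd
    (R := (∫ _, 1 ∂P + 6 * ∑' k, ∫ ω, |Y k ω| ^ p ∂P).toNNReal) fun n => ?_
  have hSi := (hSp n).integrable hp1'
  have hSI := integrable_abs_rpow hp0 (hSp n)
  rw [eLpNorm_one_eq_lintegral_enorm, ← ofReal_integral_norm_eq_lintegral_enorm hSi]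
  refine ENNReal.ofReal_le_ofReal ?_
  calc ∫ ω, ‖S n ω‖ ∂P ≤ ∫ ω, (1 + |S n ω| ^ p) ∂P := by
        refine integral_mono hSi.norm ((integrable_const 1).add hSI) fun ω => ?_
        simpa using rpow_le_one_add_rpow (abs_nonneg (S n ω)) zero_le_one hp1.le
    _ = ∫ _, 1 ∂P + ∫ ω, |S n ω| ^ p ∂P := integral_add (integrable_const 1) hSI
    _ ≤ ∫ _, 1 ∂P + 6 * ∑' k, ∫ ω, |Y k ω| ^ p ∂P := by
        gcongr
        refine (integral_abs_sum_rpow_le hp1 hp2 hY hmart hYp n).trans ?_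
        gcongr
        exact hsum.sum_le_tsum _ fun k _ => integral_nonneg fun ω => by positivity

/-- The conditional moment of order `p` of `f` given the sub-σ-algebra `m` is at most `K`. The
unconditional moment is required to be finite, since otherwise the conditional expectation is
the junk value `0`. -/
structure HasCondMomentLE {m0 : MeasurableSpace Ω} (P : Measure Ω) (m : MeasurableSpace Ω)
    (p K : ℝ) (f : Ω → ℝ) : Prop where
  integrable : Integrable (fun ω => |f ω| ^ p) P
  condExp_le : ∀ᵐ ω ∂P, (P[fun ω => |f ω| ^ p | m]) ω ≤ K

namespace HasCondMomentLE

theorem memLp (hp : 0 < p) (h : HasCondMomentLE P m p K f) (hf : AEStronglyMeasurable f P) :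
    MemLp f (ENNReal.ofReal p) P := by
  rw [← integrable_norm_rpow_iff hf (by simpa using hp) (by simp), ENNReal.toReal_ofReal hp.le]
  exact h.integrable

theorem of_abs_rpow_le [IsFiniteMeasure P] (hm : m ≤ m0) {a : ℝ} (h : HasCondMomentLE P m p K f)
    (hg : AEStronglyMeasurable g P) (hgf : ∀ᵐ ω ∂P, |g ω| ^ q ≤ a + |f ω| ^ p) :
    HasCondMomentLE P m q (a + K) g := by
  have hdom : Integrable (fun ω => a + |f ω| ^ p) P := (integrable_const a).add h.integrable
  have hint : Integrable (fun ω => |g ω| ^ q) P := by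
    refine hdom.mono' (hg.norm.aemeasurable.pow_const q).aestronglyMeasurable ?_
    filter_upwards [hgf] with ω hω
    rwa [Real.norm_of_nonneg (by positivity)]
  refine ⟨hint, ?_⟩
  have hadd : P[fun ω => a + |f ω| ^ p | m] =ᵐ[P] _ :=
    condExp_add (integrable_const a) h.integrable m
  filter_upwards [condExp_mono hint hdom hgf, hadd, h.condExp_le] with ω hmono hadd hK
  rw [hadd, Pi.add_apply, condExp_const hm] at hmono
  linarith

theorem integral_mul_le [IsFiniteMeasure P] (hm : m ≤ m0) (h : HasCondMomentLE P m p K f)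
    (hg : Measurable[m] g) (hg0 : ∀ ω, 0 ≤ g ω) {C : ℝ} (hgC : ∀ ω, g ω ≤ C) :
    ∫ ω, g ω * |f ω| ^ p ∂P ≤ K * ∫ ω, g ω ∂P := by
  have hgm : AEStronglyMeasurable g P := (hg.mono hm le_rfl).aestronglyMeasurable
  have hgC' : ∀ᵐ ω ∂P, ‖g ω‖ ≤ C :=
    ae_of_all _ fun ω => (Real.norm_of_nonneg (hg0 ω)).trans_le (hgC ω)
  have hgf : Integrable (g * fun ω => |f ω| ^ p) P := h.integrable.bdd_mul hgm hgC'
  have hpull := condExp_mul_of_stronglyMeasurable_left (μ := P) hg.stronglyMeasurable hgf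
    h.integrable
  calc ∫ ω, g ω * |f ω| ^ p ∂P = ∫ ω, (P[g * fun ω => |f ω| ^ p | m]) ω ∂P :=
        (integral_condExp hm).symm
    _ ≤ ∫ ω, K * g ω ∂P := by
        refine integral_mono_ae integrable_condExp ((Integrable.of_bound hgm C hgC').const_mul K) ?_
        filter_upwards [hpull, h.condExp_le] with ω hω hK
        rw [hω, Pi.mul_apply, mul_comm]
        exact mul_le_mul_of_nonneg_right hK (hg0 ω)
    _ = K * ∫ ω, g ω ∂P := integral_const_mul _ _

end HasCondMomentLE

theorem abs_rpow_le_of_sum_le {a : ℕ → ℝ} {R : ℝ}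
    (ha : ∀ n, ∑ k ∈ Finset.range n, |a k| ^ p ≤ R) (n : ℕ) : |a n| ^ p ≤ R :=
  (Finset.single_le_sum (f := fun k => |a k| ^ p) (fun k _ => by positivity)
    (Finset.self_mem_range_succ n)).trans (ha (n + 1))

section MartingaleTransform

variable [IsFiniteMeasure P] {ℱ : Filtration ℕ m0} {ε : ℕ → Ω → ℝ}

theorem summable_integral_abs_rpow_of_bdd {e : ℕ → Ω → ℝ} (he : ∀ n, Measurable (e n)) {R : ℝ}
    (heR : ∀ n ω, ∑ k ∈ Finset.range n, |e k ω| ^ p ≤ R) :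
    Summable fun n => ∫ ω, |e n ω| ^ p ∂P := by
  have hepR : ∀ n ω, |e n ω| ^ p ≤ R := fun n ω => abs_rpow_le_of_sum_le (heR · ω) n
  have hei : ∀ n, Integrable (fun ω => |e n ω| ^ p) P := fun n =>
    .of_bound (measurable_abs_rpow (he n)).aestronglyMeasurable R <| ae_of_all _ fun ω =>
      (Real.norm_of_nonneg (by positivity)).trans_le (hepR n ω)
  refine summable_of_sum_range_le (c := ∫ _, R ∂P)
    (fun n => integral_nonneg fun ω => by positivity) fun n => ?_
  rw [← integral_finsetSum _ fun k _ => hei k]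
  exact integral_mono (integrable_finsetSum _ fun k _ => hei k) (integrable_const R) (heR n)

theorem ae_exists_tendsto_transform_of_bdd (hp1 : 1 < p) (hp2 : p ≤ 2)
    (hε : ∀ n, Measurable[ℱ (n + 1)] (ε n)) (hmart : ∀ n, P[ε n | ℱ n] =ᵐ[P] 0)
    (hmom : ∀ n, HasCondMomentLE P (ℱ n) p K (ε n)) {e : ℕ → Ω → ℝ}
    (he : ∀ n, Measurable[ℱ n] (e n)) {R : ℝ}
    (heR : ∀ n ω, ∑ k ∈ Finset.range n, |e k ω| ^ p ≤ R) :
    ∀ᵐ ω ∂P, ∃ l, Tendsto (fun n => ∑ k ∈ Finset.range n, e k ω * ε k ω) atTop (𝓝 l) := by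
  have hp0 : 0 < p := by linarith
  have hεp : ∀ n, MemLp (ε n) (ENNReal.ofReal p) P := fun n =>
    (hmom n).memLp hp0 ((hε n).mono (ℱ.le _) le_rfl).aestronglyMeasurable
  have hεi : ∀ n, Integrable (ε n) P := fun n =>
    (hεp n).integrable (by simpa using ENNReal.ofReal_le_ofReal hp1.le)
  have he' : ∀ n, Measurable (e n) := fun n => (he n).mono (ℱ.le n) le_rfl
  have hepR : ∀ n ω, |e n ω| ^ p ≤ R := fun n ω => abs_rpow_le_of_sum_le (heR · ω) n
  have hebdd : ∀ n, ∀ᵐ ω ∂P, ‖e n ω‖ ≤ 1 + R := fun n => ae_of_all _ fun ω =>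
    calc ‖e n ω‖ = |e n ω| ^ (1 : ℝ) := (Real.rpow_one _).symm
      _ ≤ 1 + |e n ω| ^ p := rpow_le_one_add_rpow (abs_nonneg _) zero_le_one hp1.le
      _ ≤ 1 + R := by gcongr; exact hepR n ω
  have hYi : ∀ n, Integrable (fun ω => e n ω * ε n ω) P := fun n =>
    (hεi n).bdd_mul (he' n).aestronglyMeasurable (hebdd n)
  refine ae_exists_tendsto_sum_of_summable hp1 hp2
    (fun n => ((he n).mono (ℱ.mono n.le_succ) le_rfl).mul (hε n)) (fun n => ?_) (fun n => ?_) ?_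
  · have hpull := condExp_mul_of_stronglyMeasurable_left (μ := P) (he n).stronglyMeasurable
      (hYi n) (hεi n)
    filter_upwards [hpull, hmart n] with ω hω hω'
    exact hω.trans (by rw [Pi.mul_apply, hω', Pi.zero_apply, mul_zero])
  · refine MemLp.of_le_mul (c := 1 + R) (hεp n) (hYi n).1 ((hebdd n).mono fun ω hω => ?_)
    rw [norm_mul]
    gcongr
  · refine ((summable_integral_abs_rpow_of_bdd (P := P) he' heR).mul_left K).of_nonneg_of_le
      (fun n => integral_nonneg fun ω => by positivity) fun n => ?_
    simp only [abs_mul, Real.mul_rpow (abs_nonneg _) (abs_nonneg _)]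
    exact (hmom n).integral_mul_le (ℱ.le n) (measurable_abs_rpow (he n))
      (fun ω => by positivity) (hepR n)

theorem ae_exists_tendsto_transform (hp1 : 1 < p) (hp2 : p ≤ 2)
    (hε : ∀ n, Measurable[ℱ (n + 1)] (ε n)) (hmart : ∀ n, P[ε n | ℱ n] =ᵐ[P] 0)
    (hmom : ∀ n, HasCondMomentLE P (ℱ n) p K (ε n)) {d : ℕ → Ω → ℝ}
    (hd : ∀ n, Measurable[ℱ n] (d n)) :
    ∀ᵐ ω ∂P, Summable (fun n => |d n ω| ^ p) →
      ∃ l, Tendsto (fun n => ∑ k ∈ Finset.range n, d k ω * ε k ω) atTop (𝓝 l) := by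
  let D : ℕ → Ω → ℝ := fun n ω => ∑ k ∈ Finset.range (n + 1), |d k ω| ^ p
  let e : ℕ → ℕ → Ω → ℝ := fun R n ω => if D n ω ≤ R then d n ω else 0
  have hD : ∀ n, Measurable[ℱ n] (D n) := fun n =>
    Finset.measurable_fun_sum _ fun k hk => measurable_abs_rpow <|
      (hd k).mono (ℱ.mono (Nat.lt_succ_iff.1 (Finset.mem_range.1 hk))) le_rfl
  have he : ∀ R n, Measurable[ℱ n] (e R n) := fun R n =>
    Measurable.ite (measurableSet_le (hD n) measurable_const) (hd n) measurable_const
  have hbdd : ∀ R n ω, ∑ k ∈ Finset.range n, |e R k ω| ^ p ≤ R := by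
    intro R n ω
    have hzero : |(0 : ℝ)| ^ p = 0 := by rw [abs_zero, Real.zero_rpow (by linarith)]
    have hle : ∀ k, |e R k ω| ^ p ≤ |d k ω| ^ p := fun k => by
      by_cases hk : D k ω ≤ R
      · simp only [e, if_pos hk, le_refl]
      · simp only [e, if_neg hk, hzero]
        positivity
    induction n with
    | zero => simp
    | succ n ih =>
      by_cases h : D n ω ≤ R
      · exact (Finset.sum_le_sum fun k _ => hle k).trans h
      · rw [Finset.sum_range_succ, show e R n ω = 0 from if_neg h, hzero, add_zero]
        exact ih
  filter_upwards [ae_all_iff.2 fun R : ℕ =>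
    ae_exists_tendsto_transform_of_bdd hp1 hp2 hε hmart hmom (he R) (hbdd R)] with ω hω hsum
  obtain ⟨R, hR⟩ := exists_nat_ge (∑' n, |d n ω| ^ p)
  obtain ⟨l, hl⟩ := hω R
  refine ⟨l, hl.congr fun n => Finset.sum_congr rfl fun k _ => ?_⟩
  have hk : D k ω ≤ R := (hsum.sum_le_tsum _ fun i _ => by positivity).trans hR
  rw [show e R k ω = d k ω from if_pos hk]

theorem ae_eventually_abs_transform_le (hp1 : 1 < p) (hp2 : p ≤ 2)
    (hε : ∀ n, Measurable[ℱ (n + 1)] (ε n)) (hmart : ∀ n, P[ε n | ℱ n] =ᵐ[P] 0)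
    (hmom : ∀ n, HasCondMomentLE P (ℱ n) p K (ε n)) {c d : ℕ → Ω → ℝ}
    (hc : ∀ n, Measurable[ℱ n] (c n)) (hd : ∀ n, Measurable[ℱ n] (d n))
    (hdc : ∀ n ω, |d n ω| ^ p ≤ c n ω) :
    ∀ᵐ ω ∂P, ∀ δ > 0, ∃ A, ∀ᶠ n in atTop, |∑ k ∈ Finset.range n, d k ω * ε k ω| ≤
      δ * ∑ k ∈ Finset.range n, c k ω + A := by
  let C : ℕ → Ω → ℝ := fun n ω => 1 + ∑ k ∈ Finset.range n, c k ω
  have hc0 : ∀ n ω, 0 ≤ c n ω := fun n ω => le_trans (by positivity) (hdc n ω)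
  have hCpos : ∀ n ω, 0 < C n ω := fun n ω => by
    have := Finset.sum_nonneg fun k (_ : k ∈ Finset.range n) => hc0 k ω
    positivity
  have hCmono : ∀ ω, Monotone (C · ω) := fun ω => monotone_nat_of_le_succ fun n => by
    simp only [C, Finset.sum_range_succ]
    linarith [hc0 n ω]
  have hCm : ∀ n, Measurable[ℱ n] (C (n + 1)) := fun n =>
    measurable_const.add <| Finset.measurable_fun_sum _ fun k hk =>
      (hc k).mono (ℱ.mono (Nat.lt_succ_iff.1 (Finset.mem_range.1 hk))) le_rfl
  filter_upwards [ae_exists_tendsto_transform hp1 hp2 hε hmart hmom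
    (d := fun n ω => d n ω / C (n + 1) ω) fun n => (hd n).div (hCm n)] with ω hω δ hδ
  have hsum : Summable fun n => |d n ω / C (n + 1) ω| ^ p := by
    refine (summable_div_one_add_sum_rpow (hc0 · ω) hp1).of_nonneg_of_le
      (fun n => by positivity) fun n => ?_
    have hCn := hCpos (n + 1) ω
    rw [abs_div, abs_of_pos hCn, Real.div_rpow (abs_nonneg _) hCn.le]
    gcongr
    exact hdc n ω
  obtain ⟨l, hl⟩ := hω hsum
  obtain ⟨A, hA⟩ :=
    exists_eventually_abs_sum_mul_le (hCmono ω) (fun n => (hCpos n ω).le) hl hδ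
  refine ⟨δ + A, hA.mono fun n hn => ?_⟩
  have hcancel : ∀ k, C (k + 1) ω * (d k ω / C (k + 1) ω * ε k ω) = d k ω * ε k ω := fun k => by
    rw [← mul_assoc, mul_div_cancel₀ _ (hCpos _ ω).ne']
  simp only [hcancel] at hn
  linarith [show δ * C n ω = δ + δ * ∑ k ∈ Finset.range n, c k ω by ring]

end MartingaleTransform

theorem condExp_sub_condExp_eq_zero [IsFiniteMeasure P] (hm : m ≤ m0) (hf : Integrable f P) :
    P[f - P[f | m] | m] =ᵐ[P] 0 := by
  refine (condExp_sub hf integrable_condExp m).trans ?_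
  rw [condExp_of_stronglyMeasurable hm stronglyMeasurable_condExp integrable_condExp, sub_self]

namespace HasCondMomentLE

theorem of_exponent_le [IsFiniteMeasure P] (hm : m ≤ m0) (h : HasCondMomentLE P m p K f)
    (hf : AEStronglyMeasurable f P) (hq : 0 ≤ q) (hqp : q ≤ p) :
    HasCondMomentLE P m q (1 + K) f :=
  h.of_abs_rpow_le hm hf <| ae_of_all _ fun _ => rpow_le_one_add_rpow (abs_nonneg _) hq hqp

theorem condExp_sq_le [IsFiniteMeasure P] (hm : m ≤ m0) (h : HasCondMomentLE P m p K f)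
    (hf : AEStronglyMeasurable f P) (hp : 2 ≤ p) :
    ∀ᵐ ω ∂P, (P[fun ω => f ω ^ 2 | m]) ω ≤ 1 + K := by
  simpa only [Real.rpow_two, sq_abs] using (h.of_exponent_le hm hf zero_le_two hp).condExp_le

theorem sq_sub_condExp [IsFiniteMeasure P] (hm : m ≤ m0) (h : HasCondMomentLE P m (2 * p) K f)
    (hf : AEStronglyMeasurable f P) (hp : 1 ≤ p) :
    HasCondMomentLE P m p ((1 + K) ^ p + K) fun ω => f ω ^ 2 - (P[fun ω => f ω ^ 2 | m]) ω := by
  refine h.of_abs_rpow_le hm ((hf.pow 2).sub integrable_condExp.1) ?_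
  have hnonneg : 0 ≤ᵐ[P] P[fun ω => f ω ^ 2 | m] := condExp_nonneg <| ae_of_all _ fun ω =>
    sq_nonneg _
  filter_upwards [hnonneg, h.condExp_sq_le hm hf (by linarith)] with ω h0 hK
  have hp0 : 0 ≤ p := by linarith
  have hK0 : 0 ≤ (1 + K) ^ p := Real.rpow_nonneg (le_trans h0 hK) p
  have hf0 : 0 ≤ |f ω| ^ (2 * p) := by positivity
  rw [Pi.zero_apply] at h0
  rcases le_total (f ω ^ 2) ((P[fun ω => f ω ^ 2 | m]) ω) with hle | hle
  · have : |f ω ^ 2 - (P[fun ω => f ω ^ 2 | m]) ω| ≤ 1 + K :=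
      abs_le.2 ⟨by linarith [sq_nonneg (f ω)], by linarith [sq_nonneg (f ω)]⟩
    linarith [Real.rpow_le_rpow (abs_nonneg _) this hp0]
  · have : |f ω ^ 2 - (P[fun ω => f ω ^ 2 | m]) ω| ≤ |f ω| ^ 2 := by
      rw [abs_of_nonneg (sub_nonneg.2 hle), sq_abs]
      linarith
    have hpow : (|f ω| ^ 2) ^ p = |f ω| ^ (2 * p) := by
      rw [← Real.rpow_two, ← Real.rpow_mul (abs_nonneg _)]
    linarith [Real.rpow_le_rpow (abs_nonneg _) this hp0]

end HasCondMomentLE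

theorem condLExp_indicator (hm : m ≤ m0) [SigmaFinite (P.trim hm)] (X : Ω → ℝ≥0∞) {s : Set Ω}
    (hs : MeasurableSet[m] s) : P⁻[s.indicator X | m] =ᵐ[P] s.indicator (P⁻[X | m]) := by
  refine (ae_eq_condLExp hm P _ ((measurable_condLExp m P X).indicator hs)
    fun t ht => ?_).symm
  rw [setLIntegral_indicator (hm s hs), setLIntegral_indicator (hm s hs),
    setLIntegral_condLExp hm P X (hs.inter ht)]

theorem hasCondMomentLE_of_condLExp_le [IsFiniteMeasure P] (hm : m ≤ m0)
    (hf : AEStronglyMeasurable f P) (hK : 0 ≤ K)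
    (h : P⁻[fun ω => ENNReal.ofReal (|f ω| ^ p) | m] ≤ᵐ[P] fun _ => ENNReal.ofReal K) :
    HasCondMomentLE P m p K f := by
  have hnonneg : 0 ≤ᵐ[P] fun ω => |f ω| ^ p := ae_of_all _ fun ω => by positivity
  have hint : Integrable (fun ω => |f ω| ^ p) P := by
    refine (lintegral_ofReal_ne_top_iff_integrable
      (hf.norm.aemeasurable.pow_const p).aestronglyMeasurable hnonneg).1 (ne_of_lt ?_)
    calc ∫⁻ ω, ENNReal.ofReal (|f ω| ^ p) ∂P
        = ∫⁻ ω, (P⁻[fun ω => ENNReal.ofReal (|f ω| ^ p) | m]) ω ∂P :=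
          (lintegral_condLExp hm _ _).symm
      _ ≤ ∫⁻ _, ENNReal.ofReal K ∂P := lintegral_mono_ae h
      _ < ∞ := by
          rw [lintegral_const]
          finiteness
  refine ⟨hint, ?_⟩
  filter_upwards [h, condLExp_ofReal m hint hnonneg] with ω hω hreal
  rw [hreal] at hω
  exact (ENNReal.ofReal_le_ofReal_iff hK).1 hω

theorem hasCondMomentLE_indicator [IsFiniteMeasure P] (hm : m ≤ m0) (hp : p ≠ 0)
    (hf : AEStronglyMeasurable f P) (hK : 0 ≤ K) {s : Set Ω} (hs : MeasurableSet[m] s)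
    (h : ∀ ω ∈ s, (P⁻[fun ω => ENNReal.ofReal (|f ω| ^ p) | m]) ω ≤ ENNReal.ofReal K) :
    HasCondMomentLE P m p K (s.indicator f) := by
  refine hasCondMomentLE_of_condLExp_le hm (hf.indicator (hm s hs)) hK ?_
  have hind : (fun ω => ENNReal.ofReal (|s.indicator f ω| ^ p)) =
      s.indicator fun ω => ENNReal.ofReal (|f ω| ^ p) := funext fun ω => by
    by_cases hω : ω ∈ s <;> simp [hω, Real.zero_rpow hp]
  rw [hind]
  filter_upwards [condLExp_indicator hm (fun ω => ENNReal.ofReal (|f ω| ^ p)) hs] with ω hω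
  rw [hω]
  exact Set.indicator_le' (fun _ => h ω) (fun _ _ => zero_le) ω

section LaiWei

variable {ι : Type*} [Fintype ι] [DecidableEq ι] [IsFiniteMeasure P] {ℱ : Filtration ℕ m0}
  {x : ℕ → Ω → ι → ℝ} {v : ℕ → Ω → ℝ} {γ : ℝ}

theorem ae_eventually_sum_leverage_mul_le (hp1 : 1 < p) (hp2 : p ≤ 2)
    (hx : ∀ n, Measurable[ℱ n] (x n)) (hv : ∀ n, Measurable[ℱ (n + 1)] (v n))
    (hmom : ∀ n, HasCondMomentLE P (ℱ n) (2 * p) K (v n)) :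
    ∀ᵐ ω ∂P, ∃ A, ∀ᶠ n in atTop,
      ∑ k ∈ Finset.range n, leverage (regGram (x · ω) k) (x k ω) *
          (v k ω ^ 2 - (P[fun ω => v k ω ^ 2 | ℱ k]) ω) ≤
        ∑ k ∈ Finset.range n, leverage (regGram (x · ω) k) (x k ω) + A := by
  have hvm : ∀ n, AEStronglyMeasurable (v n) P := fun n =>
    ((hv n).mono (ℱ.le _) le_rfl).aestronglyMeasurable
  have hxm : ∀ n, ∀ k ≤ n, Measurable[ℱ n] (x k) := fun n k hk => (hx k).mono (ℱ.mono hk) le_rfl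
  have hlev : ∀ n, Measurable[ℱ n] fun ω => leverage (regGram (x · ω) n) (x n ω) := fun n =>
    measurable_leverage (measurable_regGram_apply fun k hk => hxm n k hk.le) (hx n)
  have hsq : ∀ n, Integrable (fun ω => v n ω ^ 2) P := fun n => by
    simpa only [Real.rpow_two, sq_abs] using
      ((hmom n).of_exponent_le (ℱ.le n) (hvm n) zero_le_two (by linarith)).integrable
  have hlaw := ae_eventually_abs_transform_le hp1 hp2
    (ε := fun n ω => v n ω ^ 2 - (P[fun ω => v n ω ^ 2 | ℱ n]) ω)
    (fun n => ((hv n).pow_const 2).sub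
      (stronglyMeasurable_condExp.measurable.mono (ℱ.mono n.le_succ) le_rfl))
    (fun n => condExp_sub_condExp_eq_zero (ℱ.le n) (hsq n))
    (fun n => (hmom n).sq_sub_condExp (ℱ.le n) (hvm n) hp1.le) hlev hlev fun n ω => by
      have hG := posDef_regGram (x · ω) n
      rw [abs_of_nonneg (leverage_nonneg hG _)]
      exact Real.rpow_le_self_of_le_one (leverage_nonneg hG _) (leverage_le_one hG _) hp1.le
  filter_upwards [hlaw] with ω hω
  obtain ⟨A, hA⟩ := hω 1 one_pos
  refine ⟨A, hA.mono fun n hn => (le_abs_self _).trans ?_⟩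
  rwa [one_mul] at hn

theorem ae_eventually_sum_ridgePrediction_mul_le
    (hx : ∀ n, Measurable[ℱ n] (x n)) (hv : ∀ n, Measurable[ℱ (n + 1)] (v n))
    (hmart : ∀ n, P[v n | ℱ n] =ᵐ[P] 0) (hmom : ∀ n, HasCondMomentLE P (ℱ n) 2 K (v n)) :
    ∀ᵐ ω ∂P, ∃ B, ∀ᶠ n in atTop,
      ∑ k ∈ Finset.range n, ridgePrediction (x · ω) (v · ω) k *
          (1 - leverage (regGram (x · ω) k) (x k ω)) * v k ω ≤
        1 / 2 * ∑ k ∈ Finset.range n, ridgePrediction (x · ω) (v · ω) k ^ 2 *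
          (1 - leverage (regGram (x · ω) k) (x k ω)) + B := by
  have hxm : ∀ n, ∀ k ≤ n, Measurable[ℱ n] (x k) := fun n k hk => (hx k).mono (ℱ.mono hk) le_rfl
  have hlev : ∀ n, Measurable[ℱ n] fun ω => 1 - leverage (regGram (x · ω) n) (x n ω) := fun n =>
    measurable_const.sub <|
      measurable_leverage (measurable_regGram_apply fun k hk => hxm n k hk.le) (hx n)
  have hpred : ∀ n, Measurable[ℱ n] fun ω => ridgePrediction (x · ω) (v · ω) n := fun n =>
    measurable_ridgePrediction (hxm n) fun k hk => (hv k).mono (ℱ.mono hk) le_rfl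
  have hlaw := ae_eventually_abs_transform_le one_lt_two le_rfl hv hmart hmom
    (fun n => ((hpred n).pow_const 2).mul (hlev n)) (fun n => (hpred n).mul (hlev n))
    fun n ω => by
      have hG := posDef_regGram (x · ω) n
      simp only [Pi.mul_apply, Real.rpow_two, sq_abs, mul_pow]
      gcongr
      exact pow_le_of_le_one (sub_nonneg.2 (leverage_le_one hG _))
        (sub_le_self _ (leverage_nonneg hG _)) two_ne_zero
  filter_upwards [hlaw] with ω hω
  obtain ⟨B, hB⟩ := hω (1 / 2) (by norm_num)
  exact ⟨B, hB.mono fun n hn => (le_abs_self _).trans hn⟩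

theorem ae_isBigO_selfNormalizedScore (hγ : 2 < γ) (hK : 0 ≤ K)
    (hx : ∀ n, Measurable[ℱ n] (x n)) (hv : ∀ n, Measurable[ℱ (n + 1)] (v n))
    (hmart : ∀ n, P[v n | ℱ n] =ᵐ[P] 0) (hmom : ∀ n, HasCondMomentLE P (ℱ n) γ K (v n)) :
    ∀ᵐ ω ∂P, selfNormalizedScore (x · ω) (v · ω) =O[atTop]
      fun n => 1 + Real.log (regGram (x · ω) n).det := by
  have hvm : ∀ n, AEStronglyMeasurable (v n) P := fun n =>
    ((hv n).mono (ℱ.le _) le_rfl).aestronglyMeasurable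
  have hp1 : 1 < min (γ / 2) 2 := lt_min (by linarith) one_lt_two
  have hpγ : 2 * min (γ / 2) 2 ≤ γ := by linarith [min_le_left (γ / 2) 2]
  filter_upwards [ae_eventually_sum_leverage_mul_le hp1 (min_le_right _ _) hx hv fun n =>
      (hmom n).of_exponent_le (ℱ.le n) (hvm n) (by linarith) hpγ,
    ae_eventually_sum_ridgePrediction_mul_le hx hv hmart fun n =>
      (hmom n).of_exponent_le (ℱ.le n) (hvm n) zero_le_two hγ.le,
    ae_all_iff.2 fun n => (hmom n).condExp_sq_le (ℱ.le n) (hvm n) hγ.le] with ω ⟨A, hA⟩ ⟨B, hB⟩ hg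
  refine .of_bound (2 + K + |A + 2 * B|) ?_
  filter_upwards [hA, hB] with n hAn hBn
  have hlog := log_det_regGram_nonneg (x · ω) n
  rw [Real.norm_of_nonneg (selfNormalizedScore_nonneg _ _ n), Real.norm_of_nonneg (by positivity)]
  have hle := selfNormalizedScore_le (x · ω) (v · ω) _ (by linarith) hg hAn hBn
  nlinarith [le_abs_self (A + 2 * B), mul_nonneg (abs_nonneg (A + 2 * B)) hlog]

theorem ae_isBigO_selfNormalizedScore_of_iSup_lt_top (hγ : 2 < γ)
    (hx : ∀ n, Measurable[ℱ n] (x n)) (hv : ∀ n, Measurable[ℱ (n + 1)] (v n))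
    (hint : ∀ n, Integrable (v n) P) (hmart : ∀ n, P[v n | ℱ n] =ᵐ[P] 0)
    (hmom : ∀ᵐ ω ∂P, ⨆ n, (P⁻[fun ω => ENNReal.ofReal (|v n ω| ^ γ) | ℱ n]) ω < ∞) :
    ∀ᵐ ω ∂P, selfNormalizedScore (x · ω) (v · ω) =O[atTop]
      fun n => 1 + Real.log (regGram (x · ω) n).det := by
  let q : ℕ → Ω → ℝ≥0∞ := fun n => P⁻[fun ω => ENNReal.ofReal (|v n ω| ^ γ) | ℱ n]
  let J : ℕ → ℕ → Set Ω := fun R n => {ω | q n ω ≤ ENNReal.ofReal R}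
  have hJ : ∀ R n, MeasurableSet[ℱ n] (J R n) := fun R n =>
    measurableSet_le (measurable_condLExp _ _ _) measurable_const
  have hloc : ∀ R : ℕ, ∀ᵐ ω ∂P,
      selfNormalizedScore (x · ω) (fun n => (J R n).indicator (v n) ω) =O[atTop]
        fun n => 1 + Real.log (regGram (x · ω) n).det := fun R => by
    refine ae_isBigO_selfNormalizedScore hγ R.cast_nonneg hx
      (fun n => (hv n).indicator (ℱ.mono n.le_succ _ (hJ R n))) (fun n => ?_) fun n =>
        hasCondMomentLE_indicator (ℱ.le n) (by linarith)
          ((hv n).mono (ℱ.le _) le_rfl).aestronglyMeasurable R.cast_nonneg (hJ R n) fun _ hω => hω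
    filter_upwards [condExp_indicator (hint n) (hJ R n), hmart n] with ω hind hzero
    rw [hind]
    exact Set.indicator_apply_eq_zero.2 fun _ => hzero
  filter_upwards [ae_all_iff.2 hloc, hmom] with ω hω hsup
  obtain ⟨R, hR⟩ := ENNReal.exists_nat_gt hsup.ne
  have hmem : ∀ n, (J R n).indicator (v n) ω = v n ω := fun n =>
    Set.indicator_of_mem (s := J R n)
      (((le_iSup (q · ω) n).trans hR.le).trans_eq (ENNReal.ofReal_natCast R).symm) _
  simpa only [hmem] using hω R

theorem ae_isBigO_selfNormalizedScore_shift (hγ : 2 < γ)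
    (hx : ∀ k ≥ 1, Measurable[ℱ k] (x k)) (hv : ∀ k ≥ 1, Measurable[ℱ (k + 1)] (v (k + 1)))
    (hint : ∀ k ≥ 1, Integrable (v (k + 1)) P)
    (hmart : ∀ k ≥ 1, P[v (k + 1) | ℱ k] =ᵐ[P] 0)
    (hmom : ∀ᵐ ω ∂P,
      ⨆ k ≥ 1, (P⁻[fun ω => ENNReal.ofReal (|v (k + 1) ω| ^ γ) | ℱ k]) ω < ∞) :
    ∀ᵐ ω ∂P, selfNormalizedScore (fun k => x (k + 1) ω) (fun k => v (k + 2) ω) =O[atTop]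
      fun n => 1 + Real.log (regGram (fun k => x (k + 1) ω) n).det := by
  let 𝒢 : Filtration ℕ _ := ⟨fun n => ℱ (n + 1), fun _ _ h => ℱ.mono (Nat.succ_le_succ h),
    fun n => ℱ.le (n + 1)⟩
  refine ae_isBigO_selfNormalizedScore_of_iSup_lt_top (ℱ := 𝒢) (x := fun n => x (n + 1))
    (v := fun n => v (n + 2)) hγ (fun n => hx _ n.succ_pos) (fun n => hv _ n.succ_pos)
    (fun n => hint _ n.succ_pos) (fun n => hmart _ n.succ_pos) ?_
  filter_upwards [hmom] with ω hω
  exact lt_of_le_of_lt (iSup_le fun n => le_iSup₂_of_le (n + 1) n.succ_pos le_rfl) hω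

end LaiWei

end Martingale

section Spectral

variable {r : ℕ} {M M' : Matrix (Fin r) (Fin r) ℝ}

theorem le_of_mem_spectrum_of_posSemidef {c μ : ℝ} (hM : (c • 1 - M).PosSemidef)
    (hμ : μ ∈ spectrum ℝ M) : μ ≤ c := by
  have hnonneg := (posSemidef_iff_isHermitian_and_spectrum_nonneg.1 hM).2
  rw [← Algebra.algebraMap_eq_smul_one, ← spectrum.singleton_sub_eq] at hnonneg
  exact sub_nonneg.1 (hnonneg (Set.sub_mem_sub rfl hμ))

theorem posSemidef_eigMax_smul_one_sub (hM : M.IsHermitian) : (eigMax M • 1 - M).PosSemidef := by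
  refine posSemidef_iff_isHermitian_and_spectrum_nonneg.2
    ⟨(isHermitian_one.smul (IsSelfAdjoint.all _)).sub hM, ?_⟩
  rw [← Algebra.algebraMap_eq_smul_one, ← spectrum.singleton_sub_eq]
  rintro _ ⟨_, rfl, μ, hμ, rfl⟩
  exact sub_nonneg.2 (le_csSup M.finite_real_spectrum.bddAbove hμ)

theorem posSemidef_sub_eigMin_smul_one (hM : M.IsHermitian) : (M - eigMin M • 1).PosSemidef := by
  refine posSemidef_iff_isHermitian_and_spectrum_nonneg.2
    ⟨hM.sub (isHermitian_one.smul (IsSelfAdjoint.all _)), ?_⟩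
  rw [← Algebra.algebraMap_eq_smul_one, ← spectrum.sub_singleton_eq]
  rintro _ ⟨μ, hμ, _, rfl, rfl⟩
  exact sub_nonneg.2 (csInf_le M.finite_real_spectrum.bddBelow hμ)

theorem dotProduct_mulVec_le_eigMax_mul (hM : M.IsHermitian) (a : Fin r → ℝ) :
    a ⬝ᵥ M *ᵥ a ≤ eigMax M * (a ⬝ᵥ a) := by
  have h := (posSemidef_eigMax_smul_one_sub hM).dotProduct_mulVec_nonneg a
  simp only [star_trivial, sub_mulVec, smul_mulVec, one_mulVec, dotProduct_sub, dotProduct_smul,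
    smul_eq_mul] at h
  exact sub_nonneg.1 h

theorem eigMin_mul_le_dotProduct_mulVec (hM : M.IsHermitian) (a : Fin r → ℝ) :
    eigMin M * (a ⬝ᵥ a) ≤ a ⬝ᵥ M *ᵥ a := by
  have h := (posSemidef_sub_eigMin_smul_one hM).dotProduct_mulVec_nonneg a
  simp only [star_trivial, sub_mulVec, smul_mulVec, one_mulVec, dotProduct_sub, dotProduct_smul,
    smul_eq_mul] at h
  exact sub_nonneg.1 h

theorem eigMin_le_eigMax (M : Matrix (Fin r) (Fin r) ℝ) : eigMin M ≤ eigMax M :=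
  Real.sInf_le_sSup _ M.finite_real_spectrum.bddBelow M.finite_real_spectrum.bddAbove

theorem posDef_of_eigMin_pos (hM : M.IsHermitian) (hpos : 0 < eigMin M) : M.PosDef := by
  have h := ((PosDef.one (n := Fin r) (R := ℝ)).smul hpos).add_posSemidef
    (posSemidef_sub_eigMin_smul_one hM)
  rwa [add_sub_cancel] at h

theorem eigMax_nonneg (hM : M.PosSemidef) : 0 ≤ eigMax M :=
  Real.sSup_nonneg fun _ hμ => (posSemidef_iff_isHermitian_and_spectrum_nonneg.1 hM).2 hμ

theorem eigMax_mono (hM : M.PosSemidef) (hMM' : (M' - M).PosSemidef) : eigMax M ≤ eigMax M' := by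
  have hM' : M'.PosSemidef := by simpa only [add_sub_cancel] using hM.add hMM'
  refine Real.sSup_le (fun μ hμ => le_of_mem_spectrum_of_posSemidef ?_ hμ) (eigMax_nonneg hM')
  simpa only [sub_add_sub_cancel] using (posSemidef_eigMax_smul_one_sub hM'.1).add hMM'

theorem det_one_add_le (hM : M.PosSemidef) : (1 + M).det ≤ (1 + eigMax M) ^ r := by
  have hM1 : (1 + M).PosSemidef := PosSemidef.one.add hM
  have hle : ∀ i, hM1.1.eigenvalues i ≤ 1 + eigMax M := fun i => by
    refine le_of_mem_spectrum_of_posSemidef ?_ (hM1.1.eigenvalues_mem_spectrum_real i)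
    rw [add_smul, one_smul, add_sub_add_left_eq_sub]
    exact posSemidef_eigMax_smul_one_sub hM.1
  rw [hM1.1.det_eq_prod_eigenvalues]
  calc ∏ i, (hM1.1.eigenvalues i : ℝ) ≤ ∏ _i : Fin r, (1 + eigMax M) :=
        Finset.prod_le_prod (fun i _ => hM1.eigenvalues_nonneg i) fun i _ => hle i
    _ = (1 + eigMax M) ^ r := by rw [Finset.prod_const, Finset.card_univ, Fintype.card_fin]

end Spectral

section QuadraticForm

variable {ι : Type*} [Fintype ι] {M : Matrix ι ι ℝ}

theorem dotProduct_self_nonneg (a : ι → ℝ) : 0 ≤ a ⬝ᵥ a :=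
  Finset.sum_nonneg fun i _ => mul_self_nonneg (a i)

theorem abs_apply_le_sqrt_dotProduct_self (a : ι → ℝ) (j : ι) : |a j| ≤ √(a ⬝ᵥ a) := by
  refine Real.abs_le_sqrt ?_
  rw [sq]
  exact Finset.single_le_sum (f := fun i => a i * a i) (fun i _ => mul_self_nonneg _)
    (Finset.mem_univ j)

theorem two_mul_dotProduct_mulVec_le (hM : M.PosSemidef) {s : ℝ} (hs : 0 < s) (a b : ι → ℝ) :
    2 * (a ⬝ᵥ M *ᵥ b) ≤ s * (a ⬝ᵥ M *ᵥ a) + s⁻¹ * (b ⬝ᵥ M *ᵥ b) := by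
  have h := hM.dotProduct_mulVec_nonneg (s • a - b)
  simp only [star_trivial, mulVec_sub, mulVec_smul, dotProduct_sub, sub_dotProduct,
    dotProduct_smul, smul_dotProduct, smul_eq_mul,
    dotProduct_mulVec_comm_of_isHermitian hM.1 b a] at h
  have hscaled := mul_nonneg (inv_nonneg.2 hs.le) h
  field_simp at hscaled ⊢
  linarith

theorem dotProduct_mulVec_sub_le (hM : M.PosSemidef) (a b : ι → ℝ) :
    (a - b) ⬝ᵥ M *ᵥ (a - b) ≤ 2 * (a ⬝ᵥ M *ᵥ a) + 2 * (b ⬝ᵥ M *ᵥ b) := by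
  have h := hM.dotProduct_mulVec_nonneg (a + b)
  simp only [star_trivial, mulVec_add, mulVec_sub, dotProduct_add, dotProduct_sub,
    add_dotProduct, sub_dotProduct] at h ⊢
  linarith

theorem two_mul_dotProduct_sub_le [DecidableEq ι] (hM : M.PosDef) (a S : ι → ℝ) :
    2 * (a ⬝ᵥ S) - a ⬝ᵥ M *ᵥ a ≤ S ⬝ᵥ M⁻¹ *ᵥ S := by
  have h := two_mul_dotProduct_mulVec_le hM.posSemidef one_pos a (M⁻¹ *ᵥ S)
  rw [mulVec_mulVec, mul_nonsing_inv _ hM.det_pos.ne'.isUnit, one_mulVec,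
    dotProduct_comm (M⁻¹ *ᵥ S)] at h
  linarith

theorem dotProduct_mulVec_le_two_mul_inv [DecidableEq ι] (hM : M.PosSemidef) {e : ι → ℝ}
    (he : e ⬝ᵥ e ≤ e ⬝ᵥ M *ᵥ e) :
    e ⬝ᵥ M *ᵥ e ≤ 2 * ((M *ᵥ e) ⬝ᵥ (1 + M)⁻¹ *ᵥ (M *ᵥ e)) := by
  have h := two_mul_dotProduct_sub_le (PosDef.one.add_posSemidef hM) ((1 / 2 : ℝ) • e) (M *ᵥ e)
  simp only [smul_dotProduct, mulVec_smul, dotProduct_smul, add_mulVec, one_mulVec,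
    dotProduct_add, smul_eq_mul] at h
  linarith

theorem tendsto_of_tendsto_dotProduct_sub {α : Type*} {l : Filter α} {b : α → ι → ℝ} {θ : ι → ℝ}
    (h : Tendsto (fun n => (b n - θ) ⬝ᵥ (b n - θ)) l (𝓝 0)) : Tendsto b l (𝓝 θ) := by
  refine tendsto_pi_nhds.2 fun i => tendsto_iff_dist_tendsto_zero.2 ?_
  exact squeeze_zero (fun n => dist_nonneg)
    (fun n => abs_apply_le_sqrt_dotProduct_self (b n - θ) i) (by simpa using h.sqrt)

end QuadraticForm

section WeightedPenalty

variable {ι : Type*} [Fintype ι] {p B θ b : ι → ℝ}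

theorem sum_mul_abs_le_add_mul_sqrt (hp : ∀ l, 0 ≤ p l) (hB : ∀ l, 0 ≤ B l)
    (hpB : ∀ l, θ l ≠ 0 → p l ≤ B l) :
    ∑ l, p l * |θ l| ≤ ∑ l, p l * |b l| + (∑ l, B l) * √((b - θ) ⬝ᵥ (b - θ)) := by
  rw [Finset.sum_mul, ← Finset.sum_add_distrib]
  refine Finset.sum_le_sum fun l _ => ?_
  rcases eq_or_ne (θ l) 0 with hθ | hθ
  · rw [hθ, abs_zero, mul_zero]
    exact add_nonneg (mul_nonneg (hp l) (abs_nonneg _)) (mul_nonneg (hB l) (Real.sqrt_nonneg _))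
  · calc p l * |θ l| ≤ p l * (|b l| + |(b - θ) l|) := by
          refine mul_le_mul_of_nonneg_left ?_ (hp l)
          simpa only [Pi.sub_apply, sub_sub_cancel] using abs_sub (b l) ((b - θ) l)
      _ = p l * |b l| + p l * |(b - θ) l| := mul_add _ _ _
      _ ≤ p l * |b l| + B l * √((b - θ) ⬝ᵥ (b - θ)) := by
          gcongr
          · exact hB l
          · exact hpB l hθ
          · exact abs_apply_le_sqrt_dotProduct_self (b - θ) l

theorem sum_mul_abs_sub_single [DecidableEq ι] (p b : ι → ℝ) (j : ι) :
    ∑ l, p l * |(b - Pi.single j (b j) : ι → ℝ) l| = ∑ l, p l * |b l| - p j * |b j| := by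
  have hterm : ∀ l, p l * |(b - Pi.single j (b j) : ι → ℝ) l| =
      p l * |b l| - if l = j then p l * |b l| else 0 := fun l => by
    rcases eq_or_ne l j with rfl | hl <;> simp [*]
  simp only [hterm, Finset.sum_sub_distrib, Finset.sum_ite_eq', Finset.mem_univ, if_true]

end WeightedPenalty

section LeastSquares

variable {r : ℕ} {x : ℕ → Fin r → ℝ} {z : ℕ → ℝ} {N : ℕ}

theorem posSemidef_gram (x : ℕ → Fin r → ℝ) (N : ℕ) : (gram x N).PosSemidef :=
  posSemidef_sum _ fun k _ => posSemidef_vecMulVec_self (x k)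

theorem lamMax_mono (x : ℕ → Fin r → ℝ) : Monotone (lamMax x) :=
  monotone_nat_of_le_succ fun N => eigMax_mono (posSemidef_gram x N) <| by
    rw [gram, gram, Finset.sum_Icc_succ_top N.succ_pos, add_sub_cancel_left]
    exact posSemidef_vecMulVec_self _

theorem gram_mulVec (x : ℕ → Fin r → ℝ) (N : ℕ) (b : Fin r → ℝ) :
    gram x N *ᵥ b = ∑ k ∈ Finset.Icc 1 N, (b ⬝ᵥ x k) • x k := by
  simp only [gram, sum_mulVec, vecMulVec_mulVec, op_smul_eq_smul, dotProduct_comm b]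

theorem gram_mulVec_lsEstimate (h : 0 < lamMin x N) :
    gram x N *ᵥ lsEstimate x z N = ∑ k ∈ Finset.Icc 1 N, z (k + 1) • x k := by
  have hG := posDef_of_eigMin_pos (posSemidef_gram x N).1 h
  rw [lsEstimate, mulVec_mulVec, mul_nonsing_inv _ hG.det_pos.ne'.isUnit, one_mulVec]

theorem sum_residual_smul_eq_zero (h : 0 < lamMin x N) :
    ∑ k ∈ Finset.Icc 1 N, (z (k + 1) - lsEstimate x z N ⬝ᵥ x k) • x k = 0 := by
  simp only [sub_smul, Finset.sum_sub_distrib, ← gram_mulVec, gram_mulVec_lsEstimate h, sub_self]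

/-- The excess `(θ_{N+1} - b)ᵀ (∑ x_k x_kᵀ) (θ_{N+1} - b)` of the residual sum of squares at `b`
over its minimum, attained at the least squares estimate `θ_{N+1}`. -/
def lsExcess (x : ℕ → Fin r → ℝ) (z : ℕ → ℝ) (N : ℕ) (b : Fin r → ℝ) : ℝ :=
  (lsEstimate x z N - b) ⬝ᵥ gram x N *ᵥ (lsEstimate x z N - b)

theorem lsExcess_nonneg (x : ℕ → Fin r → ℝ) (z : ℕ → ℝ) (N : ℕ) (b : Fin r → ℝ) :
    0 ≤ lsExcess x z N b := by
  simpa only [star_trivial, lsExcess] using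
    (posSemidef_gram x N).dotProduct_mulVec_nonneg (lsEstimate x z N - b)

theorem sum_residual_sq (h : 0 < lamMin x N) (b : Fin r → ℝ) :
    ∑ k ∈ Finset.Icc 1 N, (z (k + 1) - b ⬝ᵥ x k) ^ 2 =
      ∑ k ∈ Finset.Icc 1 N, (z (k + 1) - lsEstimate x z N ⬝ᵥ x k) ^ 2 + lsExcess x z N b := by
  set d := lsEstimate x z N - b with hd
  have horth : ∑ k ∈ Finset.Icc 1 N,
      (z (k + 1) - lsEstimate x z N ⬝ᵥ x k) * (d ⬝ᵥ x k) = 0 := by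
    simpa only [dotProduct_sum, dotProduct_smul, smul_eq_mul, dotProduct_zero] using
      congrArg (d ⬝ᵥ ·) (sum_residual_smul_eq_zero (z := z) h)
  have hterm : ∀ k, (z (k + 1) - b ⬝ᵥ x k) ^ 2 = (z (k + 1) - lsEstimate x z N ⬝ᵥ x k) ^ 2 +
      2 * ((z (k + 1) - lsEstimate x z N ⬝ᵥ x k) * (d ⬝ᵥ x k)) +
        (d ⬝ᵥ x k) * (d ⬝ᵥ x k) := fun k => by
    rw [hd, sub_dotProduct]
    ring
  simp only [hterm, Finset.sum_add_distrib, ← Finset.mul_sum, horth, mul_zero, add_zero,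
    lsExcess, ← hd, gram_mulVec, dotProduct_sum, dotProduct_smul, smul_eq_mul]

theorem lsExcess_add_penalty_le {c : ℝ} (h : 0 < lamMin x N) {b b' : Fin r → ℝ}
    (hb : criterion x z c N b ≤ criterion x z c N b') :
    lsExcess x z N b + c * ∑ l, 1 / |modEstimate x z N l| * |b l| ≤
      lsExcess x z N b' + c * ∑ l, 1 / |modEstimate x z N l| * |b' l| := by
  rw [criterion, criterion, sum_residual_sq h b, sum_residual_sq h b'] at hb
  linarith

theorem lsExcess_sub_le (x : ℕ → Fin r → ℝ) (z : ℕ → ℝ) (N : ℕ) (b d : Fin r → ℝ) {s : ℝ}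
    (hs : 0 < s) :
    lsExcess x z N (b - d) ≤
      lsExcess x z N b + (1 + s⁻¹) * (d ⬝ᵥ gram x N *ᵥ d) + s * lsExcess x z N b := by
  have hG := posSemidef_gram x N
  have hcross := two_mul_dotProduct_mulVec_le hG hs (lsEstimate x z N - b) d
  have hcomm := dotProduct_mulVec_comm_of_isHermitian hG.1 (lsEstimate x z N - b) d
  rw [lsExcess, sub_sub_eq_add_sub, add_sub_right_comm, mulVec_add, add_dotProduct,
    dotProduct_add, dotProduct_add, ← hcomm]
  rw [lsExcess]
  linarith

theorem lamMin_mul_dotProduct_le_lsExcess (x : ℕ → Fin r → ℝ) (z : ℕ → ℝ) (N : ℕ)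
    (b : Fin r → ℝ) :
    lamMin x N * ((lsEstimate x z N - b) ⬝ᵥ (lsEstimate x z N - b)) ≤ lsExcess x z N b :=
  eigMin_mul_le_dotProduct_mulVec (posSemidef_gram x N).1 _

theorem lsExcess_le_lamMax_mul_dotProduct (x : ℕ → Fin r → ℝ) (z : ℕ → ℝ) (N : ℕ)
    (b : Fin r → ℝ) :
    lsExcess x z N b ≤ lamMax x N * ((lsEstimate x z N - b) ⬝ᵥ (lsEstimate x z N - b)) :=
  dotProduct_mulVec_le_eigMax_mul (posSemidef_gram x N).1 _

theorem rate_nonneg (x : ℕ → Fin r → ℝ) (N : ℕ) : 0 ≤ rate x N :=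
  Real.sqrt_nonneg _

theorem rate_pos (hmin : 0 < lamMin x N) (hmax : 1 < lamMax x N) : 0 < rate x N :=
  Real.sqrt_pos.2 (div_pos (Real.log_pos hmax) hmin)

theorem rate_sq (hmin : 0 < lamMin x N) (hmax : 1 < lamMax x N) :
    rate x N ^ 2 = Real.log (lamMax x N) / lamMin x N :=
  Real.sq_sqrt (div_nonneg (Real.log_nonneg hmax.le) hmin.le)

theorem abs_modEstimate (x : ℕ → Fin r → ℝ) (z : ℕ → ℝ) (N : ℕ) (j : Fin r) :
    |modEstimate x z N j| = |lsEstimate x z N j| + rate x N := by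
  have hrate := rate_nonneg x N
  rw [modEstimate, sgn]
  split_ifs with h
  · rw [one_mul, abs_of_nonneg (add_nonneg h hrate), abs_of_nonneg h]
  · rw [abs_of_neg (by linarith), abs_of_neg (by linarith)]
    ring

theorem sum_Icc_one_eq_sum_range {E : Type*} [AddCommMonoid E] (f : ℕ → E) (N : ℕ) :
    ∑ k ∈ Finset.Icc 1 N, f k = ∑ k ∈ Finset.range N, f (k + 1) := by
  rw [Finset.range_eq_Ico, Finset.sum_Ico_add' f 0 N 1]
  rfl

theorem regGram_shift (x : ℕ → Fin r → ℝ) (N : ℕ) :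
    regGram (fun k => x (k + 1)) N = 1 + gram x N := by
  rw [regGram, gram, sum_Icc_one_eq_sum_range]

theorem gram_mulVec_lsEstimate_sub (h : 0 < lamMin x N) {θ : Fin r → ℝ} {v : ℕ → ℝ}
    (hz : ∀ k ≥ 1, z (k + 1) = θ ⬝ᵥ x k + v (k + 1)) :
    gram x N *ᵥ (lsEstimate x z N - θ) =
      score (fun k => x (k + 1)) (fun k => v (k + 2)) N := by
  rw [mulVec_sub, gram_mulVec_lsEstimate h, gram_mulVec, ← Finset.sum_sub_distrib,
    sum_Icc_one_eq_sum_range, score]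
  refine Finset.sum_congr rfl fun k _ => ?_
  rw [hz (k + 1) k.succ_pos, add_smul, add_sub_cancel_left]

theorem lsExcess_le_two_mul_selfNormalizedScore (h : 1 ≤ lamMin x N) {θ : Fin r → ℝ} {v : ℕ → ℝ}
    (hz : ∀ k ≥ 1, z (k + 1) = θ ⬝ᵥ x k + v (k + 1)) :
    lsExcess x z N θ ≤
      2 * selfNormalizedScore (fun k => x (k + 1)) (fun k => v (k + 2)) N := by
  rw [selfNormalizedScore, regGram_shift, ← gram_mulVec_lsEstimate_sub (zero_lt_one.trans_le h) hz]
  refine dotProduct_mulVec_le_two_mul_inv (posSemidef_gram x N) ?_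
  exact (le_mul_of_one_le_left (dotProduct_self_nonneg _) h).trans
    (lamMin_mul_dotProduct_le_lsExcess x z N θ)

theorem log_det_regGram_shift_le (h : 2 ≤ lamMax x N) :
    Real.log (regGram (fun k => x (k + 1)) N).det ≤ 2 * r * Real.log (lamMax x N) := by
  have hdet : (regGram (fun k => x (k + 1)) N).det ≤ (lamMax x N ^ 2) ^ r := by
    rw [regGram_shift]
    refine (det_one_add_le (posSemidef_gram x N)).trans (pow_le_pow_left₀ ?_ ?_ r)
    · exact add_nonneg zero_le_one (eigMax_nonneg (posSemidef_gram x N))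
    · rw [← lamMax]
      nlinarith
  refine (Real.log_le_log (posDef_regGram _ N).det_pos hdet).trans_eq ?_
  rw [Real.log_pow, Real.log_pow]
  push_cast
  ring

theorem dotProduct_sub_le_of_criterion_le (h : 0 < lamMin x N) {c : ℝ} (hc : 0 ≤ c)
    {θ b : Fin r → ℝ} (hmod : ∀ l, θ l ≠ 0 → 1 / |modEstimate x z N l| ≤ 2 / |θ l|)
    (hb : criterion x z c N b ≤ criterion x z c N θ) :
    (b - θ) ⬝ᵥ (b - θ) ≤ 8 * (lsExcess x z N θ / lamMin x N) +
      (2 * (∑ l, 2 / |θ l|) * (c / lamMin x N)) ^ 2 := by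
  set D := (b - θ) ⬝ᵥ (b - θ) with hD
  set B := ∑ l, 2 / |θ l|
  have hsplit : lamMin x N * D ≤ 2 * lsExcess x z N θ + 2 * lsExcess x z N b := by
    rw [hD, ← sub_sub_sub_cancel_left θ b (lsEstimate x z N)]
    exact (eigMin_mul_le_dotProduct_mulVec (posSemidef_gram x N).1 _).trans
      (dotProduct_mulVec_sub_le (posSemidef_gram x N) _ _)
  have hpen : ∑ l, 1 / |modEstimate x z N l| * |θ l| ≤
      ∑ l, 1 / |modEstimate x z N l| * |b l| + B * √D :=
    sum_mul_abs_le_add_mul_sqrt (fun l => by positivity) (fun l => by positivity) hmod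
  have hquad : lamMin x N * D ≤ 4 * lsExcess x z N θ + 2 * c * (B * √D) := by
    linarith [lsExcess_add_penalty_le h hb, mul_le_mul_of_nonneg_left hpen hc]
  have hle : D ≤ 4 * (lsExcess x z N θ / lamMin x N) + 2 * B * (c / lamMin x N) * √D := by
    rw [← le_div_iff₀' h] at hquad
    exact hquad.trans_eq (by ring)
  have hsqrt : √D ^ 2 = D := Real.sq_sqrt (dotProduct_self_nonneg _)
  linarith [sq_nonneg (2 * B * (c / lamMin x N) - √D)]

theorem mul_inv_abs_modEstimate_le (h : 0 < lamMin x N) {c : ℝ} {b : Fin r → ℝ}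
    (hb : ∀ b', criterion x z c N b ≤ criterion x z c N b') {j : Fin r} (hj : b j ≠ 0) :
    c * (1 / |modEstimate x z N j|) ≤ lamMax x N *
      (|b j| + 1 + (lsEstimate x z N - b) ⬝ᵥ (lsEstimate x z N - b)) := by
  set d : Fin r → ℝ := Pi.single j (b j) with hd
  have hbj : 0 < |b j| := abs_pos.2 hj
  have hmin := lsExcess_add_penalty_le h (hb (b - d))
  rw [hd, sum_mul_abs_sub_single, ← hd] at hmin
  have hexcess := lsExcess_sub_le x z N b d hbj
  have hquad : (1 + |b j|⁻¹) * (d ⬝ᵥ gram x N *ᵥ d) ≤ lamMax x N * (|b j| + 1) * |b j| := by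
    have hdd : d ⬝ᵥ d = |b j| ^ 2 := by simp [hd, sq]
    calc (1 + |b j|⁻¹) * (d ⬝ᵥ gram x N *ᵥ d)
        ≤ (1 + |b j|⁻¹) * (lamMax x N * |b j| ^ 2) := by
          rw [← hdd]
          gcongr
          exact dotProduct_mulVec_le_eigMax_mul (posSemidef_gram x N).1 d
      _ = lamMax x N * (|b j| + 1) * |b j| := by field_simp
  have hls := mul_le_mul_of_nonneg_left (lsExcess_le_lamMax_mul_dotProduct x z N b) hbj.le
  refine le_of_mul_le_mul_right ?_ hbj
  linarith

end LeastSquares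

section Pathwise

open Asymptotics

variable {r : ℕ} {x : ℕ → Fin r → ℝ} {z v c : ℕ → ℝ} {θ : Fin r → ℝ} {b : ℕ → Fin r → ℝ}

theorem tendsto_lamMax_atTop (hmin : Tendsto (lamMin x) atTop atTop) :
    Tendsto (lamMax x) atTop atTop :=
  tendsto_atTop_mono (fun _ => eigMin_le_eigMax _) hmin

theorem tendsto_rate (hpos : ∀ᶠ N in atTop, 0 < lamMin x N)
    (hc : ∀ᶠ N in atTop, 0 < c N) (hc₁ : Tendsto (fun N => c N / lamMin x N) atTop (𝓝 0))
    (hc₂ : Tendsto (fun N => lamMax x N * rate x N / c N) atTop (𝓝 0)) :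
    Tendsto (rate x) atTop (𝓝 0) := by
  have hprod : Tendsto (fun N => c N / lamMin x N * (lamMax x N * rate x N / c N)) atTop (𝓝 0) := by
    simpa only [mul_zero] using hc₁.mul hc₂
  refine squeeze_zero' (.of_forall (rate_nonneg x)) ?_ hprod
  filter_upwards [hpos, hc] with N hN hcN
  have hcond : 1 ≤ lamMax x N / lamMin x N := (one_le_div hN).2 (eigMin_le_eigMax _)
  calc rate x N ≤ lamMax x N / lamMin x N * rate x N :=
        le_mul_of_one_le_left (rate_nonneg x N) hcond
    _ = c N / lamMin x N * (lamMax x N * rate x N / c N) := by field_simp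

theorem tendsto_lamMin_atTop (hpos : ∀ᶠ N in atTop, 0 < lamMin x N ∧ 1 < lamMax x N)
    (hrate : Tendsto (rate x) atTop (𝓝 0)) : Tendsto (lamMin x) atTop atTop := by
  obtain ⟨N₀, hN₀⟩ := eventually_atTop.1 hpos
  have hlog : 0 < Real.log (lamMax x N₀) := Real.log_pos (hN₀ N₀ le_rfl).2
  have hsq : Tendsto (fun N => rate x N ^ 2) atTop (𝓝[>] 0) := by
    refine tendsto_nhdsWithin_iff.2 ⟨by simpa using hrate.pow 2, ?_⟩
    filter_upwards [hpos] with N hN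
    exact pow_pos (rate_pos hN.1 hN.2) 2
  refine tendsto_atTop_mono' _ ?_ (hsq.inv_tendsto_nhdsGT_zero.const_mul_atTop hlog)
  filter_upwards [eventually_ge_atTop N₀] with N hN
  obtain ⟨hmin, hmax⟩ := hN₀ N hN
  have hmono : Real.log (lamMax x N₀) ≤ Real.log (lamMax x N) :=
    Real.log_le_log (by linarith [(hN₀ N₀ le_rfl).2]) (lamMax_mono x hN)
  rw [Pi.inv_apply, rate_sq hmin hmax, inv_div, ← mul_div_assoc, div_le_iff₀ (Real.log_pos hmax),
    mul_comm]
  gcongr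

theorem isBigO_one_add_log_det_regGram (hmax : Tendsto (lamMax x) atTop atTop) :
    (fun N => 1 + Real.log (regGram (fun k => x (k + 1)) N).det)
      =O[atTop] fun N => Real.log (lamMax x N) := by
  refine .add ?_ (.of_bound (2 * r) ?_)
  · exact (isLittleO_const_left.2 <| .inr <|
      tendsto_norm_atTop_atTop.comp <| Real.tendsto_log_atTop.comp hmax).isBigO
  · filter_upwards [hmax.eventually_ge_atTop 2] with N hN
    rw [Real.norm_of_nonneg (log_det_regGram_nonneg _ N),
      Real.norm_of_nonneg (Real.log_nonneg (one_le_two.trans hN))]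
    exact log_det_regGram_shift_le hN

theorem isBigO_lsExcess (hz : ∀ k ≥ 1, z (k + 1) = θ ⬝ᵥ x k + v (k + 1))
    (hmin : Tendsto (lamMin x) atTop atTop)
    (hscore : selfNormalizedScore (fun k => x (k + 1)) (fun k => v (k + 2))
      =O[atTop] fun N => 1 + Real.log (regGram (fun k => x (k + 1)) N).det) :
    (fun N => lsExcess x z N θ) =O[atTop] fun N => Real.log (lamMax x N) := by
  refine .trans (.of_bound 2 ?_)
    (hscore.trans (isBigO_one_add_log_det_regGram (tendsto_lamMax_atTop hmin)))
  filter_upwards [hmin.eventually_ge_atTop 1] with N hN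
  rw [Real.norm_of_nonneg (lsExcess_nonneg x z N θ),
    Real.norm_of_nonneg (selfNormalizedScore_nonneg _ _ N)]
  exact lsExcess_le_two_mul_selfNormalizedScore hN hz

theorem isBigO_lsExcess_div_lamMin (hpos : ∀ᶠ N in atTop, 0 < lamMin x N ∧ 1 < lamMax x N)
    (hls : (fun N => lsExcess x z N θ) =O[atTop] fun N => Real.log (lamMax x N)) :
    (fun N => lsExcess x z N θ / lamMin x N) =O[atTop] fun N => rate x N ^ 2 := by
  refine (hls.mul (isBigO_refl (fun N => (lamMin x N)⁻¹) atTop)).congr'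
    (.of_forall fun N => rfl) ?_
  filter_upwards [hpos] with N hN
  rw [rate_sq hN.1 hN.2, div_eq_mul_inv]

theorem isBigO_dotProduct_lsEstimate_sub (hpos : ∀ᶠ N in atTop, 0 < lamMin x N)
    (hls : (fun N => lsExcess x z N θ / lamMin x N) =O[atTop] fun N => rate x N ^ 2) :
    (fun N => (lsEstimate x z N - θ) ⬝ᵥ (lsEstimate x z N - θ))
      =O[atTop] fun N => rate x N ^ 2 := by
  refine .trans (.of_bound' ?_) hls
  filter_upwards [hpos] with N hN
  rw [Real.norm_of_nonneg (dotProduct_self_nonneg _)]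
  refine le_trans ?_ (Real.le_norm_self _)
  rw [le_div_iff₀' hN]
  exact lamMin_mul_dotProduct_le_lsExcess x z N θ

theorem isBigO_lsEstimate_sub_apply
    (hls : (fun N => (lsEstimate x z N - θ) ⬝ᵥ (lsEstimate x z N - θ))
      =O[atTop] fun N => rate x N ^ 2) (j : Fin r) :
    (fun N => lsEstimate x z N j - θ j) =O[atTop] rate x := by
  refine .of_pow two_ne_zero (.trans (.of_bound' (.of_forall fun N => ?_)) hls)
  rw [Pi.pow_apply, Real.norm_of_nonneg (sq_nonneg _),
    Real.norm_of_nonneg (dotProduct_self_nonneg _), sq]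
  exact Finset.single_le_sum (f := fun i => (lsEstimate x z N - θ) i * (lsEstimate x z N - θ) i)
    (fun i _ => mul_self_nonneg _) (Finset.mem_univ j)

theorem isBigO_modEstimate {j : Fin r} (hθ : θ j = 0)
    (hls : (fun N => lsEstimate x z N j - θ j) =O[atTop] rate x) :
    (fun N => modEstimate x z N j) =O[atTop] rate x := by
  rw [hθ] at hls
  simp only [sub_zero] at hls
  refine .trans (.of_norm_eventuallyLE (.of_forall fun N => ?_))
    (hls.norm_left.add (isBigO_refl (rate x) atTop))
  exact (abs_modEstimate x z N j).le

theorem eventually_inv_abs_modEstimate_le (hls : Tendsto (lsEstimate x z) atTop (𝓝 θ)) :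
    ∀ᶠ N in atTop, ∀ l, θ l ≠ 0 → 1 / |modEstimate x z N l| ≤ 2 / |θ l| := by
  refine eventually_all.2 fun l => ?_
  rcases eq_or_ne (θ l) 0 with hl | hl
  · exact .of_forall fun N h => absurd hl h
  · have habs : 0 < |θ l| := abs_pos.2 hl
    filter_upwards [(tendsto_pi_nhds.1 hls l).abs.eventually_const_le (half_lt_self habs)]
      with N hN _
    have hmod : |θ l| / 2 ≤ |modEstimate x z N l| :=
      hN.trans (by linarith [abs_modEstimate x z N l, rate_nonneg x N])
    simpa only [one_div_div] using one_div_le_one_div_of_le (half_pos habs) hmod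

theorem tendsto_of_isMinOn_criterion (hpos : ∀ᶠ N in atTop, 0 < lamMin x N)
    (hc : ∀ᶠ N in atTop, 0 < c N) (hc₁ : Tendsto (fun N => c N / lamMin x N) atTop (𝓝 0))
    (hls : Tendsto (lsEstimate x z) atTop (𝓝 θ))
    (hexcess : Tendsto (fun N => lsExcess x z N θ / lamMin x N) atTop (𝓝 0))
    (hb : ∀ᶠ N in atTop, IsMinOn (criterion x z (c N) N) Set.univ (b N)) :
    Tendsto b atTop (𝓝 θ) := by
  refine tendsto_of_tendsto_dotProduct_sub ?_
  set D : ℕ → ℝ := fun N => (b N - θ) ⬝ᵥ (b N - θ)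
  set B := ∑ l, 2 / |θ l|
  have hbound : ∀ᶠ N in atTop,
      D N ≤ 8 * (lsExcess x z N θ / lamMin x N) + (2 * B * (c N / lamMin x N)) ^ 2 := by
    filter_upwards [hpos, hc, eventually_inv_abs_modEstimate_le hls, hb] with N hN hcN hmod hbN
    exact dotProduct_sub_le_of_criterion_le hN hcN.le hmod (hbN (Set.mem_univ θ))
  refine squeeze_zero' (.of_forall fun N => dotProduct_self_nonneg _) hbound ?_
  simpa using (hexcess.const_mul 8).add ((hc₁.const_mul (2 * B)).pow 2)

theorem eventually_eq_zero_of_isMinOn_criterion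
    (hpos : ∀ᶠ N in atTop, 0 < lamMin x N ∧ 1 < lamMax x N) (hc : ∀ᶠ N in atTop, 0 < c N)
    (hc₂ : Tendsto (fun N => lamMax x N * rate x N / c N) atTop (𝓝 0))
    (hls : Tendsto (lsEstimate x z) atTop (𝓝 θ)) (hbθ : Tendsto b atTop (𝓝 θ))
    (hb : ∀ᶠ N in atTop, IsMinOn (criterion x z (c N) N) Set.univ (b N)) {j : Fin r}
    (hj : θ j = 0) (hmod : (fun N => modEstimate x z N j) =O[atTop] rate x) :
    ∀ᶠ N in atTop, b N j = 0 := by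
  have hweight : Tendsto (fun N => lamMax x N * modEstimate x z N j / c N) atTop (𝓝 0) := by
    have hO := ((isBigO_refl (lamMax x) atTop).mul hmod).mul (isBigO_refl (fun N => (c N)⁻¹) atTop)
    exact hO.trans_tendsto hc₂
  have hfactor : Tendsto (fun N => |b N j| + 1 +
      (lsEstimate x z N - b N) ⬝ᵥ (lsEstimate x z N - b N)) atTop (𝓝 1) := by
    have hbj := (tendsto_pi_nhds.1 hbθ j).abs
    have hdiff := hls.sub hbθ
    have hcont : Continuous fun a : Fin r → ℝ => a ⬝ᵥ a := continuous_id.dotProduct continuous_id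
    simpa [hj] using (hbj.add_const 1).add ((hcont.tendsto _).comp hdiff)
  have hsmall := hweight.abs.mul hfactor
  rw [abs_zero, zero_mul] at hsmall
  filter_upwards [hpos, hc, hb, hsmall.eventually_lt_const one_pos] with N hN hcN hbN hlt
  by_contra hne
  have hmod_pos : 0 < |modEstimate x z N j| := by
    linarith [abs_modEstimate x z N j, abs_nonneg (lsEstimate x z N j), rate_pos hN.1 hN.2]
  have hle := mul_inv_abs_modEstimate_le hN.1 (fun b' => hbN (Set.mem_univ b')) hne
  rw [mul_one_div, div_le_iff₀ hmod_pos] at hle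
  rw [abs_div, abs_mul, abs_of_pos (zero_lt_one.trans hN.2), abs_of_pos hcN, div_mul_eq_mul_div,
    div_lt_one hcN] at hlt
  linarith

theorem eventually_eq_zero_and_tendsto (hz : ∀ k ≥ 1, z (k + 1) = θ ⬝ᵥ x k + v (k + 1))
    (hscore : selfNormalizedScore (fun k => x (k + 1)) (fun k => v (k + 2))
      =O[atTop] fun N => 1 + Real.log (regGram (fun k => x (k + 1)) N).det)
    (hpos : ∀ᶠ N in atTop, 0 < lamMin x N ∧ 1 < lamMax x N) (hc : ∀ᶠ N in atTop, 0 < c N)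
    (hc₁ : Tendsto (fun N => c N / lamMin x N) atTop (𝓝 0))
    (hc₂ : Tendsto (fun N => lamMax x N * rate x N / c N) atTop (𝓝 0))
    (hb : ∀ᶠ N in atTop, IsMinOn (criterion x z (c N) N) Set.univ (b N)) :
    (∀ᶠ N in atTop, ∀ j, θ j = 0 → b N j = 0) ∧ Tendsto b atTop (𝓝 θ) := by
  have hpos_min := hpos.mono fun N hN => hN.1
  have hrate := tendsto_rate hpos_min hc hc₁ hc₂
  have hrate_sq : Tendsto (fun N => rate x N ^ 2) atTop (𝓝 0) := by simpa using hrate.pow 2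
  have hexcess := isBigO_lsExcess_div_lamMin hpos
    (isBigO_lsExcess hz (tendsto_lamMin_atTop hpos hrate) hscore)
  have herror := isBigO_dotProduct_lsEstimate_sub hpos_min hexcess
  have hls := tendsto_of_tendsto_dotProduct_sub (herror.trans_tendsto hrate_sq)
  have hbθ := tendsto_of_isMinOn_criterion hpos_min hc hc₁ hls (hexcess.trans_tendsto hrate_sq) hb
  refine ⟨eventually_all.2 fun j => ?_, hbθ⟩
  rcases eq_or_ne (θ j) 0 with hj | hj
  · filter_upwards [eventually_eq_zero_of_isMinOn_criterion hpos hc hc₂ hls hbθ hb hj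
      (isBigO_modEstimate hj (isBigO_lsEstimate_sub_apply herror j))] with N hN _ using hN
  · exact .of_forall fun N h => absurd h hj

end Pathwise

section Information

variable {Ω U V : Type*} [MeasurableSpace U] [MeasurableSpace V] {y : ℕ → Ω → ℝ} {u : ℕ → Ω → U}
  {w : ℕ → Ω → ℝ} {w' : ℕ → Ω → V}

theorem info_mono : Monotone (info y u w w') := fun _ _ h =>
  sup_le_sup (sup_le_sup (sup_le_sup
    (biSup_mono fun _ hi => le_trans hi h) (biSup_mono fun _ hi => lt_of_lt_of_le hi h))
    (biSup_mono fun _ hi => le_trans hi h)) (biSup_mono fun _ hi => le_trans hi h)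

theorem measurable_noise_info (k : ℕ) : Measurable[info y u w w' k] (w k) :=
  Measurable.mono (comap_measurable (w k))
    ((le_iSup₂_of_le (f := fun i (_ : i ∈ Set.Iic k) => MeasurableSpace.comap (w i) inferInstance)
      k (Set.mem_Iic.2 le_rfl) le_rfl).trans (le_sup_right.trans le_sup_left)) le_rfl

variable [mΩ : MeasurableSpace Ω]

theorem info_le (hy : ∀ k, Measurable (y k)) (hu : ∀ k, Measurable (u k))
    (hw : ∀ k, Measurable (w k)) (hw' : ∀ k, Measurable (w' k)) (k : ℕ) :
    info y u w w' k ≤ mΩ :=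
  sup_le (sup_le (sup_le
    (iSup₂_le fun i _ => (hy i).comap_le) (iSup₂_le fun i _ => (hu i).comap_le))
    (iSup₂_le fun i _ => (hw i).comap_le)) (iSup₂_le fun i _ => (hw' i).comap_le)

/-- The information sigma-algebras `info y u w w' k`, bundled as a filtration. -/
def infoFiltration (hy : ∀ k, Measurable (y k)) (hu : ∀ k, Measurable (u k))
    (hw : ∀ k, Measurable (w k)) (hw' : ∀ k, Measurable (w' k)) : Filtration ℕ mΩ where
  seq := info y u w w'
  mono' := info_mono
  le' := info_le hy hu hw hw'

end Information

end SparseId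

end

theorem theorem1_general {Ω : Type*} {mΩ : MeasurableSpace Ω} (P : Measure Ω) [IsFiniteMeasure P]
    (ℱ : Filtration ℕ mΩ) {r : ℕ} (θ : Fin r → ℝ) (φ : ℕ → Ω → Fin r → ℝ) (y w : ℕ → Ω → ℝ)
    (hw : ∀ k ≥ 1, Measurable[ℱ (k + 1)] (w (k + 1)))
    (hsys : ∀ k ≥ 1, ∀ ω, y (k + 1) ω = θ ⬝ᵥ φ k ω + w (k + 1) ω)
    (hint : ∀ k ≥ 1, Integrable (w (k + 1)) P)
    (hmart : ∀ k ≥ 1, P[w (k + 1) | ℱ k] =ᵐ[P] 0) (γ : ℝ) (hγ : 2 < γ)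
    (hmom : ∀ᵐ ω ∂P, (⨆ k ≥ 1, condLExp (ℱ k) P
      (fun ω' => ENNReal.ofReal (|w (k + 1) ω'| ^ γ)) ω) < ⊤)
    (hφ : ∀ k ≥ 1, Measurable[ℱ k] (φ k))
    (hpos : ∀ᵐ ω ∂P, ∀ᶠ N in atTop,
      0 < SparseId.lamMin (φ · ω) N ∧ 1 < SparseId.lamMax (φ · ω) N)
    (lam : ℕ → Ω → ℝ) (hlam : ∀ᵐ ω ∂P, ∀ᶠ N in atTop, 0 < lam N ω)
    (hlam₁ : ∀ᵐ ω ∂P, Tendsto (fun N => lam N ω / SparseId.lamMin (φ · ω) N) atTop (𝓝 0))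
    (hlam₂ : ∀ᵐ ω ∂P, Tendsto (fun N => SparseId.lamMax (φ · ω) N *
      SparseId.rate (φ · ω) N / lam N ω) atTop (𝓝 0))
    (β : ℕ → Ω → Fin r → ℝ)
    (hβ : ∀ᵐ ω ∂P, ∀ᶠ N in atTop,
      IsMinOn (SparseId.criterion (φ · ω) (y · ω) (lam N ω) N) Set.univ (β (N + 1) ω)) :
    ∀ᵐ ω ∂P, (∀ᶠ N in atTop, ∀ j, θ j = 0 → β (N + 1) ω j = 0) ∧
      Tendsto (fun N => β (N + 1) ω) atTop (𝓝 θ) := by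
  filter_upwards [SparseId.ae_isBigO_selfNormalizedScore_shift hγ hφ hw hint hmart hmom,
    hpos, hlam, hlam₁, hlam₂, hβ] with ω hscore hposω hlamω hlam₁ω hlam₂ω hβω
  exact SparseId.eventually_eq_zero_and_tendsto (v := (w · ω)) (fun k hk => hsys k hk ω)
    hscore hposω hlamω hlam₁ω hlam₂ω hβω

theorem theorem1 {Ω : Type*} [MeasurableSpace Ω] (P : Measure Ω) [IsProbabilityMeasure P]
    {U V : Type*} [MeasurableSpace U] [MeasurableSpace V] {r : ℕ}
    -- parameter, regressors, outputs, inputs, noise, exogenous signals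
    (θ : Fin r → ℝ) (φ : ℕ → Ω → Fin r → ℝ) (y : ℕ → Ω → ℝ) (u : ℕ → Ω → U)
    (w : ℕ → Ω → ℝ) (w' : ℕ → Ω → V)
    (hy : ∀ k, Measurable (y k)) (hu : ∀ k, Measurable (u k))
    (hw : ∀ k, Measurable (w k)) (hw' : ∀ k, Measurable (w' k))
    -- the system
    (hsys : ∀ k ω, y (k + 1) ω = θ ⬝ᵥ φ k ω + w (k + 1) ω)
    -- A1: martingale difference noise with bounded conditional moments of order `γ > 2`
    (hint : ∀ k ≥ 1, Integrable (w (k + 1)) P)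
    (hmart : ∀ k ≥ 1, P[w (k + 1) | SparseId.info y u w w' k] =ᵐ[P] 0)
    (γ : ℝ) (hγ : 2 < γ)
    (hmom : ∀ᵐ ω ∂P, (⨆ k ≥ 1, condLExp (SparseId.info y u w w' k) P
      (fun ω' => ENNReal.ofReal (|w (k + 1) ω'| ^ γ)) ω) < ⊤)
    -- A2: adapted regressors
    (hφ : ∀ k ≥ 1, Measurable[SparseId.info y u w w' k] (φ k))
    -- the quantities in A3 and A4 are eventually well defined and positive
    (hpos : ∀ᵐ ω ∂P, ∀ᶠ N in atTop,
      0 < SparseId.lamMin (φ · ω) N ∧ 1 < SparseId.lamMax (φ · ω) N)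
    -- A3: excitation
    (hexc : ∀ᵐ ω ∂P, Tendsto (fun N => SparseId.lamMax (φ · ω) N / SparseId.lamMin (φ · ω) N *
      SparseId.rate (φ · ω) N) atTop (𝓝 0))
    -- A4: choice of the regularization coefficients (which may depend on the data)
    (lam : ℕ → Ω → ℝ) (hlam : ∀ᵐ ω ∂P, ∀ᶠ N in atTop, 0 < lam N ω)
    (hlam₁ : ∀ᵐ ω ∂P, Tendsto (fun N => lam N ω / SparseId.lamMin (φ · ω) N) atTop (𝓝 0))
    (hlam₂ : ∀ᵐ ω ∂P, Tendsto (fun N => SparseId.lamMax (φ · ω) N *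
      SparseId.rate (φ · ω) N / lam N ω) atTop (𝓝 0))
    -- the estimates: minimizers of the weighted criterion
    (β : ℕ → Ω → Fin r → ℝ)
    (hβ : ∀ᵐ ω ∂P, ∀ᶠ N in atTop,
      IsMinOn (SparseId.criterion (φ · ω) (y · ω) (lam N ω) N) Set.univ (β (N + 1) ω)) :
    ∀ᵐ ω ∂P,
      (∃ N₀ : ℕ, ∀ N ≥ N₀, ∀ j, θ j = 0 → β (N + 1) ω j = 0) ∧
      (∀ i, θ i ≠ 0 → Tendsto (fun N => β (N + 1) ω i) atTop (𝓝 (θ i))) := by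
  filter_upwards [theorem1_general P (SparseId.infoFiltration hy hu hw hw') θ φ y w
    (fun k _ => SparseId.measurable_noise_info (k + 1)) (fun k _ => hsys k) hint hmart γ hγ hmom
    hφ hpos lam hlam hlam₁ hlam₂ β hβ] with ω ⟨hzero, hlim⟩
  exact ⟨eventually_atTop.1 hzero, fun i _ => tendsto_pi_nhds.1 hlim i⟩
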